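/- For partitions $\lambda,\mu,\nu$ let $c^{\lambda}_{\mu\nu}$ denote the Littlewood--Richardson coefficient, that is, the coefficient of the Schur function $s_\lambda$ in the expansion $s_\mu s_\nu=\sum_\lambda c^\lambda_{\mu\nu}s_\lambda$. Let $|\tau|$ be the sum of the parts of a partition $\tau$ and $\tau'$ its conjugate (transposed) partition. For any partitions $\lambda,\mu,\nu$ and $\omega$ we have $$\sum_{\gamma,\eta,\sigma,\tau}(-1)^{|\tau|}\,c^{\gamma}_{\tau'\nu}\,c^{\lambda}_{\gamma\eta}\,c^{\sigma}_{\eta\mu}\,c^{\omega}_{\sigma\tau}=\delta_{\lambda\nu}\,\delta_{\mu\omega},$$ where $\gamma,\eta,\sigma,\tau$ run over all partitions (only finitely many terms of the sum are non-zero). Equivalently, if we let $c^{\nu}_{\lambda\mu\eta}=\sum_{\xi}c^{\xi}_{\lambda\mu}\,c^{\nu}_{\xi\eta}$ (sum over all partitions $\xi$), then, again with only finitely many non-zero terms, $$\sum_{\eta,\tau}(-1)^{|\tau|}\,c^{\lambda}_{\tau'\nu\eta}\,c^{\omega}_{\eta\mu\tau}=\delta_{\lambda\nu}\,\delta_{\mu\omega}.$$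 -/

import Mathlib

/-!
Partitions are Mathlib's `YoungDiagram`s: `lam.rowLen i` is the `i`-th part (indices from `0`),
`lam.colLen 0` the length, `lam.card` the degree and `lam.transpose` the conjugate partition.
-/

noncomputable section

namespace LR

/-- The alternant `det (x_i ^ (lam_j + N - j))_{1 ≤ i, j ≤ N}` in `N` variables. -/
def alternant (lam : YoungDiagram) (N : ℕ) : MvPolynomial (Fin N) ℤ :=
  Matrix.det (Matrix.of fun i j : Fin N =>
    (MvPolynomial.X i : MvPolynomial (Fin N) ℤ) ^ (lam.rowLen j + (j.rev : ℕ)))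

/-- The Schur polynomial `s_lam(x_1, …, x_N)`: the ratio of the alternant of `lam` by the Vandermonde
determinant (the alternant of the empty partition) if `lam` has at most `N` parts, and `0` otherwise.
It is written in the field of fractions of `ℤ[x_1, …, x_N]`. -/
def schurPoly (lam : YoungDiagram) (N : ℕ) : FractionRing (MvPolynomial (Fin N) ℤ) :=
  if lam.colLen 0 ≤ N then
    algebraMap _ (FractionRing (MvPolynomial (Fin N) ℤ)) (alternant lam N) /
      algebraMap _ (FractionRing (MvPolynomial (Fin N) ℤ)) (alternant ⊥ N)
  else 0

/-- The Schur function `s_lam`, as the compatible family of its restrictions to finitely many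
variables. The ring of symmetric functions, being the (graded) inverse limit of the rings of
symmetric polynomials in `N` variables, is a subring of this product ring. -/
def schur (lam : YoungDiagram) : (N : ℕ) → FractionRing (MvPolynomial (Fin N) ℤ) :=
  fun N => schurPoly lam N

open Classical in
/-- Kronecker's delta. -/
def delta (lam mu : YoungDiagram) : ℤ := if lam = mu then 1 else 0

theorem coeff_alternant {N : ℕ} {lam mu : YoungDiagram} (hl : lam.colLen 0 ≤ N)
    (hm : mu.colLen 0 ≤ N) :
    MvPolynomial.coeff (Finsupp.equivFunOnFinite.symm fun j : Fin N => mu.rowLen j + (j.rev : ℕ))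
      (alternant lam N) = delta lam mu := by
  classical
  have mono : ∀ nu : YoungDiagram,
      StrictAnti fun j : Fin N => nu.rowLen j + (j.rev : ℕ) := by
    intro nu i j hij
    have h1 := nu.rowLen_anti i j (by exact_mod_cast hij.le)
    have h2 : (j.rev : ℕ) < i.rev := by exact_mod_cast Fin.rev_lt_rev.2 hij
    simp only
    omega
  have key : ∀ s : Equiv.Perm (Fin N),
      MvPolynomial.coeff (Finsupp.equivFunOnFinite.symm fun j : Fin N => mu.rowLen j + (j.rev : ℕ))
        (∏ i, (MvPolynomial.X (s i) : MvPolynomial (Fin N) ℤ) ^ (lam.rowLen i + (i.rev : ℕ))) =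
        if s = 1 ∧ lam = mu then 1 else 0 := by
    intro s
    have e : (∏ i, (MvPolynomial.X (s i) : MvPolynomial (Fin N) ℤ) ^ (lam.rowLen i + (i.rev : ℕ)))
        = MvPolynomial.monomial (Finsupp.equivFunOnFinite.symm
            fun j : Fin N => lam.rowLen (s.symm j) + ((s.symm j).rev : ℕ)) 1 := by
      rw [MvPolynomial.monomial_eq, Finsupp.prod_fintype _ _ (by simp), map_one, one_mul]
      refine Fintype.prod_equiv s _ _ fun i => ?_
      simp
    rw [e, MvPolynomial.coeff_monomial]
    refine if_congr ?_ rfl rfl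
    rw [Equiv.apply_eq_iff_eq]
    constructor
    · intro h
      have hanti : StrictMono s.symm := by
        intro i j hij
        have h1 := mono mu hij
        rw [← h] at h1
        exact (mono lam).lt_iff_gt.1 h1
      have hs : s.symm = 1 := by
        have : ({ s.symm with map_rel_iff' := hanti.le_iff_le } : Fin N ≃o Fin N) =
            OrderIso.refl _ := Subsingleton.elim _ _
        ext i
        have := congrArg (fun f => ((f i : Fin N) : ℕ)) this
        simpa using this
      have hs' : s = 1 := by
        rw [← Equiv.symm_symm s, hs]; rfl
      refine ⟨hs', ?_⟩
      subst hs'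
      have hrow : ∀ i, lam.rowLen i = mu.rowLen i := by
        intro i
        by_cases hi : i < N
        · have := congrFun h ⟨i, hi⟩
          exact Nat.add_right_cancel this
        · have z : ∀ nu : YoungDiagram, nu.colLen 0 ≤ N → nu.rowLen i = 0 := by
            intro nu hn
            by_contra h0
            have := YoungDiagram.mem_iff_lt_colLen.1
              (YoungDiagram.mem_iff_lt_rowLen.2 (Nat.pos_of_ne_zero h0))
            omega
          rw [z _ hl, z _ hm]
      refine SetLike.ext fun c => ?_
      obtain ⟨i, j⟩ := c
      rw [YoungDiagram.mem_iff_lt_rowLen, YoungDiagram.mem_iff_lt_rowLen, hrow]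
    · rintro ⟨rfl, rfl⟩
      rfl
  rw [alternant, Matrix.det_apply, MvPolynomial.coeff_sum]
  simp only [Matrix.of_apply, MvPolynomial.coeff_smul, key]
  rw [Finset.sum_eq_single 1]
  · simp [delta]
  · intro s _ hs
    simp [hs]
  · simp

theorem alternant_ne_zero {N : ℕ} {lam : YoungDiagram} (hl : lam.colLen 0 ≤ N) :
    alternant lam N ≠ 0 := by
  intro h
  have := coeff_alternant hl hl
  simp [h, delta] at this

/-- The Schur functions are linearly independent. -/
theorem linearIndependent_schur : LinearIndependent ℤ schur := by
  rw [linearIndependent_iff]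
  intro c hc
  ext mu
  by_contra hmu
  let N := c.support.sup fun lam => lam.colLen 0
  have hN : ∀ lam ∈ c.support, lam.colLen 0 ≤ N := fun lam h =>
    Finset.le_sup (f := fun lam : YoungDiagram => lam.colLen 0) h
  have h0 : alternant ⊥ N ≠ 0 := by
    refine alternant_ne_zero (Nat.le_trans (Nat.le_of_eq ?_) (Nat.zero_le _))
    simp [YoungDiagram.colLen_eq_card, YoungDiagram.col]
  have h0' : algebraMap _ (FractionRing (MvPolynomial (Fin N) ℤ)) (alternant ⊥ N) ≠ 0 := by
    simpa using h0
  have h1 := congrFun hc N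
  rw [Finsupp.linearCombination_apply, Finsupp.sum, Finset.sum_apply] at h1
  have h2 : algebraMap _ (FractionRing (MvPolynomial (Fin N) ℤ))
      (∑ lam ∈ c.support, c lam • alternant lam N) = 0 := by
    have h3 := congrArg
      (fun z => algebraMap _ (FractionRing (MvPolynomial (Fin N) ℤ)) (alternant ⊥ N) * z) h1
    simp only [Pi.zero_apply, mul_zero] at h3
    rw [← h3, map_sum, Finset.mul_sum]
    refine Finset.sum_congr rfl fun lam hlam => ?_
    simp only [Pi.smul_apply, schur, schurPoly, if_pos (hN lam hlam), map_zsmul, mul_smul_comm,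
      mul_div_cancel₀ _ h0']
  rw [map_eq_zero_iff _ (IsFractionRing.injective _ _)] at h2
  have h4 := congrArg (MvPolynomial.coeff
    (Finsupp.equivFunOnFinite.symm fun j : Fin N => mu.rowLen j + (j.rev : ℕ))) h2
  have hmu' : mu ∈ c.support := Finsupp.mem_support_iff.2 hmu
  rw [MvPolynomial.coeff_sum, Finset.sum_eq_single mu] at h4
  · rw [MvPolynomial.coeff_smul, coeff_alternant (hN mu hmu') (hN mu hmu')] at h4
    simp [delta] at h4
    exact hmu h4
  · intro lam hlam hne
    rw [MvPolynomial.coeff_smul, coeff_alternant (hN lam hlam) (hN mu hmu')]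
    simp [delta, hne]
  · exact fun h => absurd hmu' h

open Classical in
/-- The coefficients of the expansion of `s_mu s_nu` in the basis of Schur functions
(these coefficients are unique by `linearIndependent_schur`). -/
def schurMulCoeffs (mu nu : YoungDiagram) : YoungDiagram →₀ ℤ :=
  if h : ∃ c : YoungDiagram →₀ ℤ, schur mu * schur nu = c.sum fun lam a => a • schur lam then
    h.choose
  else 0

/-- The Littlewood–Richardson coefficient `c^lam_{mu nu}` (upper index first): the coefficient of
`s_lam` in `s_mu s_nu`. -/
def lrCoeff (lam mu nu : YoungDiagram) : ℤ := schurMulCoeffs mu nu lam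

/-- The triple coefficient `c^nu_{lam mu eta} = ∑_xi c^xi_{lam mu} c^nu_{xi eta}` (upper index
first). The sum has finitely many non-zero terms since `schurMulCoeffs lam mu` is finitely
supported. -/
def lrCoeff₃ (nu lam mu eta : YoungDiagram) : ℤ :=
  ∑ᶠ xi : YoungDiagram, lrCoeff xi lam mu * lrCoeff nu xi eta

end LR

end

noncomputable section

namespace LR

open MvPolynomial

/-! ### Young diagrams -/

/-! The triple coefficients are the coefficients of a product of three Schur functions, so they do
not depend on how the product is bracketed or ordered (`lrCoeff₃_eq_of_mul_eq`). Multiplying by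
$s_\nu$ and by $s_\mu$ last gives $c^\lambda_{\tau'\nu\eta}=\sum_\alpha
c^\alpha_{\tau'\eta}c^\lambda_{\alpha\nu}$ and $c^\omega_{\eta\mu\tau}=\sum_\beta
c^\beta_{\tau\eta}c^\omega_{\beta\mu}$. Everything then follows from the antipode relation
$\sum_{\tau,\eta}(-1)^{|\tau|}c^\alpha_{\tau'\eta}c^\beta_{\tau\eta}=\delta_{\alpha\emptyset}\delta_{\beta\emptyset}$
(`sum_lrCoeff_transpose_mul_lrCoeff`).

That relation compares the coefficients of $s_\alpha(x)s_\beta(y)$ in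
$\prod(1-x_iy_j)\cdot\prod(1-x_iy_j)^{-1}=1$, the two factors being expanded by the dual Cauchy
identity and the Cauchy identity. The $y$-coefficients of these expansions are Jacobi–Trudi
determinants in $x$ (`sum_eDet_mul_hDet`); `altEval_eq_mul_hDet` and `altEval_mul_eDet` identify
them with $s_\eta(x)$ and $(-1)^{|\tau|}s_{\tau'}(x)$.

Symmetric polynomials are handled through their products with the Vandermonde determinant: an
antisymmetric polynomial is determined by its coefficients at strictly decreasing exponents. The
same principle shows that products of Schur functions expand with coefficients independent of the
number of variables (`exists_isExpansion`), so that `lrCoeff` does not take its default value for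
want of an expansion. -/

theorem rowLen_eq_zero_of_colLen_le {lam : YoungDiagram} {N i : ℕ} (h : lam.colLen 0 ≤ N)
    (hi : N ≤ i) : lam.rowLen i = 0 := by
  by_contra h0
  have := YoungDiagram.mem_iff_lt_colLen.1
    (YoungDiagram.mem_iff_lt_rowLen.2 (Nat.pos_of_ne_zero h0))
  omega

theorem ext_rowLen {lam mu : YoungDiagram} (h : ∀ i, lam.rowLen i = mu.rowLen i) : lam = mu := by
  refine SetLike.ext fun c => ?_
  obtain ⟨i, j⟩ := c
  rw [YoungDiagram.mem_iff_lt_rowLen, YoungDiagram.mem_iff_lt_rowLen, h]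

@[simp] theorem rowLen_bot (i : ℕ) : (⊥ : YoungDiagram).rowLen i = 0 := by
  simp [YoungDiagram.rowLen_eq_card, YoungDiagram.row]

@[simp] theorem colLen_bot (i : ℕ) : (⊥ : YoungDiagram).colLen i = 0 := by
  simp [YoungDiagram.colLen_eq_card, YoungDiagram.col]

theorem card_transpose (lam : YoungDiagram) : lam.transpose.card = lam.card := by
  refine Finset.card_bij (fun c _ => c.swap) ?_ ?_ ?_
  · intro c hc
    simpa using hc
  · intro a _ b _ h
    simpa using h
  · intro c hc
    exact ⟨c.swap, by simpa using hc, by simp⟩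

theorem card_eq_zero_iff {lam : YoungDiagram} : lam.card = 0 ↔ lam = ⊥ := by
  rw [YoungDiagram.card, Finset.card_eq_zero]
  exact ⟨fun h => YoungDiagram.ext (by simpa using h), fun h => by simp [h]⟩

theorem colLen_le_card (lam : YoungDiagram) (j : ℕ) : lam.colLen j ≤ lam.card := by
  rw [YoungDiagram.colLen_eq_card]
  exact Finset.card_le_card (Finset.filter_subset _ _)

theorem rowLen_le_card (lam : YoungDiagram) (j : ℕ) : lam.rowLen j ≤ lam.card := by
  rw [YoungDiagram.rowLen_eq_card]
  exact Finset.card_le_card (Finset.filter_subset _ _)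

theorem card_eq_sum_rowLen {lam : YoungDiagram} {N : ℕ} (h : lam.colLen 0 ≤ N) :
    lam.card = ∑ j : Fin N, lam.rowLen j := by
  have hmap : ∀ c ∈ lam.cells, c.1 ∈ Finset.range N := by
    rintro ⟨i, j⟩ hc
    by_contra hi
    have h1 := rowLen_eq_zero_of_colLen_le h (i := i) (by simpa using hi)
    have h2 := YoungDiagram.mem_iff_lt_rowLen.1 ((YoungDiagram.mem_cells _).1 hc)
    omega
  rw [YoungDiagram.card, Finset.card_eq_sum_card_fiberwise hmap,
    ← Fin.sum_univ_eq_sum_range (fun i => (lam.cells.filter fun c => c.1 = i).card)]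
  exact Finset.sum_congr rfl fun j _ => (lam.rowLen_eq_card).symm

theorem finite_card_le (d : ℕ) : {lam : YoungDiagram | lam.card ≤ d}.Finite := by
  refine Set.Finite.of_finite_image (f := YoungDiagram.cells)
    (((Finset.range d ×ˢ Finset.range d).powerset.finite_toSet).subset ?_) ?_
  · rintro _ ⟨lam, hlam, rfl⟩
    simp only [Finset.coe_powerset, Set.mem_preimage, Set.mem_powerset_iff, Finset.coe_subset]
    rintro ⟨i, j⟩ hc
    have h1 := YoungDiagram.mem_iff_lt_rowLen.1 ((YoungDiagram.mem_cells _).1 hc)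
    have h2 := YoungDiagram.mem_iff_lt_colLen.1 ((YoungDiagram.mem_cells _).1 hc)
    have h3 := rowLen_le_card lam i
    have h4 := colLen_le_card lam j
    have h5 : lam.card ≤ d := hlam
    simp only [Finset.mem_product, Finset.mem_range]
    omega
  · intro a _ b _ h
    exact YoungDiagram.ext h

/-- The diagrams with at most `d` cells. -/
def diagramsLE (d : ℕ) : Finset YoungDiagram := (finite_card_le d).toFinset

@[simp] theorem mem_diagramsLE {d : ℕ} {lam : YoungDiagram} :
    lam ∈ diagramsLE d ↔ lam.card ≤ d := by
  simp [diagramsLE]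

/-- The exponents `lam_j + N - j` of the leading monomial of the alternant of `lam`. -/
def exponent (lam : YoungDiagram) (N : ℕ) : Fin N →₀ ℕ :=
  Finsupp.equivFunOnFinite.symm fun j : Fin N => lam.rowLen j + (j.rev : ℕ)

@[simp] theorem exponent_apply (lam : YoungDiagram) {N : ℕ} (j : Fin N) :
    exponent lam N j = lam.rowLen j + (j.rev : ℕ) := rfl

theorem degree_exponent {lam : YoungDiagram} {N : ℕ} (h : lam.colLen 0 ≤ N) :
    (exponent lam N).degree = lam.card + ∑ j : Fin N, (j.rev : ℕ) := by
  rw [Finsupp.degree_eq_sum, card_eq_sum_rowLen h, ← Finset.sum_add_distrib]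
  rfl

/-- Subtracting the staircase from a strictly decreasing vector of naturals leaves a weakly
decreasing one, which is the list of rows of the diagram. -/
theorem exists_exponent_eq {N : ℕ} {k : Fin N →₀ ℕ} (hk : StrictAnti k) :
    ∃ lam : YoungDiagram, lam.colLen 0 ≤ N ∧ exponent lam N = k := by
  have hstep : ∀ i j : Fin N, i ≤ j → k j + (j : ℕ) ≤ k i + (i : ℕ) := by
    intro i j hij
    obtain ⟨i, hi⟩ := i
    obtain ⟨j, hj⟩ := j
    simp only [Fin.mk_le_mk] at hij ⊢
    induction j, hij using Nat.le_induction with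
    | base => exact le_rfl
    | succ j hij ih =>
      have h1 := ih (by omega)
      have h2 : k ⟨j + 1, hj⟩ < k ⟨j, by omega⟩ := hk (by simp [Fin.lt_def])
      omega
  -- Comparison with the last index; it makes the truncated subtraction of the staircase exact.
  have hrev : ∀ j : Fin N, (j.rev : ℕ) ≤ k j := by
    intro j
    have hj := j.2
    have h1 := hstep j ⟨N - 1, by omega⟩ (Fin.le_def.2 (by simp only; omega))
    rw [Fin.val_rev]
    simp only at h1
    omega
  have hs : (List.ofFn fun j : Fin N => k j - (j.rev : ℕ)).SortedGE := by
    rw [List.sortedGE_ofFn_iff]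
    intro i j hij
    have h1 := hstep i j hij
    have h2 := hrev i
    have h3 := hrev j
    simp only [Fin.val_rev] at *
    have := i.2
    have := j.2
    omega
  refine ⟨YoungDiagram.ofRowLens _ hs, ?_, ?_⟩
  · by_contra hc
    have h1 := YoungDiagram.mem_iff_lt_colLen.2 (not_le.1 hc)
    obtain ⟨h2, _⟩ := YoungDiagram.mem_ofRowLens.1 h1
    simp at h2
  · ext j
    have h1 := YoungDiagram.rowLen_ofRowLens (hw := hs) ⟨j, by simp⟩
    simp only [exponent_apply] at h1 ⊢
    rw [h1]
    have := hrev j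
    simp only [Fin.getElem_fin, List.getElem_ofFn, Fin.eta]
    omega

/-! ### Determinants of univariate polynomials evaluated at the variables -/

section evalDet

variable {A : Type*} [CommRing A] {N : ℕ}

theorem coeff_prod_aeval_X (g : Fin N → Polynomial A) (k : Fin N →₀ ℕ) :
    coeff k (∏ i, Polynomial.aeval (X i : MvPolynomial (Fin N) A) (g i)) =
      ∏ i, (g i).coeff (k i) := by
  classical
  let M := (Finset.univ.sup fun i => (g i).natDegree) + (Finset.univ.sup fun i => k i) + 1
  have hM : ∀ i, (g i).natDegree < M := fun i =>
    Nat.lt_succ_of_le (le_add_right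
      (Finset.le_sup (f := fun i => (g i).natDegree) (Finset.mem_univ i)))
  have hk : ∀ i, k i < M := fun i =>
    Nat.lt_succ_of_le (le_add_left (Finset.le_sup (f := fun i => k i) (Finset.mem_univ i)))
  have h1 : ∀ i, Polynomial.aeval (X i : MvPolynomial (Fin N) A) (g i) =
      ∑ n ∈ Finset.range M, monomial (Finsupp.single i n) ((g i).coeff n) := by
    intro i
    rw [Polynomial.aeval_eq_sum_range' (hM i)]
    refine Finset.sum_congr rfl fun n _ => ?_
    rw [X_pow_eq_monomial, smul_monomial, smul_eq_mul, mul_one]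
  simp only [h1]
  rw [Finset.prod_univ_sum, coeff_sum]
  have h2 : ∀ p : Fin N → ℕ, ∏ i, monomial (Finsupp.single i (p i)) ((g i).coeff (p i)) =
      monomial (Finsupp.equivFunOnFinite.symm p) (∏ i, (g i).coeff (p i)) := by
    intro p
    rw [← monomial_sum_prod]
    congr 2
    ext j
    simp [Finsupp.finsetSum_apply, Finsupp.single_apply]
  simp only [h2, coeff_monomial]
  rw [Finset.sum_eq_single (k : Fin N → ℕ)]
  · rw [if_pos]
    ext; rfl
  · intro p _ hp
    rw [if_neg]
    rintro rfl
    exact hp rfl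
  · intro h
    exact absurd (Fintype.mem_piFinset.2 fun i => Finset.mem_range.2 (hk i)) h

/-- The determinant `det (f_j (x_i))`. -/
def evalDet (f : Fin N → Polynomial A) : MvPolynomial (Fin N) A :=
  Matrix.det (Matrix.of fun i j : Fin N => Polynomial.aeval (X i : MvPolynomial (Fin N) A) (f j))

/-- In each term of the determinant the variables separate, so a coefficient is extracted row by
row. This is how Jacobi–Trudi determinants appear as coefficients. -/
theorem coeff_evalDet (f : Fin N → Polynomial A) (k : Fin N →₀ ℕ) :
    coeff k (evalDet f) = Matrix.det (Matrix.of fun i j : Fin N => (f j).coeff (k i)) := by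
  rw [evalDet, ← Matrix.det_transpose, Matrix.det_apply, coeff_sum, ← Matrix.det_transpose,
    Matrix.det_apply]
  refine Finset.sum_congr rfl fun s _ => ?_
  simp only [Matrix.transpose_apply, Matrix.of_apply]
  rw [Units.smul_def, Units.smul_def, ← coeff_prod_aeval_X, coeff_smul]

theorem rename_evalDet (f : Fin N → Polynomial A) (s : Equiv.Perm (Fin N)) :
    rename s (evalDet f) = (Equiv.Perm.sign s : ℤ) • evalDet f := by
  rw [evalDet, AlgHom.map_det, zsmul_eq_mul, ← Matrix.det_permute]
  congr 1
  ext1 i j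
  simp [← Polynomial.aeval_algHom_apply]

/-- Row `i` has the common factor `g (x_i)`. With staircase powers for `f`, this is the Vandermonde
determinant times $\prod_i g(x_i)$, the shape of both Cauchy kernels. -/
theorem evalDet_mul (f : Fin N → Polynomial A) (g : Polynomial A) :
    evalDet (fun j => f j * g) =
      evalDet f * ∏ i, Polynomial.aeval (X i : MvPolynomial (Fin N) A) g := by
  rw [evalDet, evalDet, mul_comm, ← Matrix.det_mul_column]
  simp [mul_comm]

/-- The alternant of a diagram over an arbitrary ring of coefficients. -/
def alternantOver (A : Type*) [CommRing A] (lam : YoungDiagram) (N : ℕ) : MvPolynomial (Fin N) A :=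
  evalDet fun j : Fin N => Polynomial.X ^ (lam.rowLen j + (j.rev : ℕ))

theorem alternantOver_int (lam : YoungDiagram) (N : ℕ) :
    alternantOver ℤ lam N = alternant lam N := by
  simp [alternantOver, evalDet, alternant]

theorem map_alternant (lam : YoungDiagram) (N : ℕ) :
    map (Int.castRingHom A) (alternant lam N) = alternantOver A lam N := by
  rw [alternantOver, evalDet, alternant, RingHom.map_det]
  congr 1
  ext1 i j
  simp

theorem coeff_alternantOver {lam mu : YoungDiagram} (hl : lam.colLen 0 ≤ N)
    (hm : mu.colLen 0 ≤ N) :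
    coeff (exponent mu N) (alternantOver A lam N) = (delta lam mu : A) := by
  rw [← map_alternant, coeff_map, exponent, coeff_alternant hl hm]
  simp

theorem alternantOver_isHomogeneous {lam : YoungDiagram} (h : lam.colLen 0 ≤ N) :
    (alternantOver A lam N).IsHomogeneous (lam.card + ∑ j : Fin N, (j.rev : ℕ)) := by
  rw [← degree_exponent h, alternantOver, evalDet, Matrix.det_apply]
  refine IsHomogeneous.sum _ _ _ fun s _ => ?_
  rw [Units.smul_def, zsmul_eq_mul, ← map_intCast (C : A →+* MvPolynomial (Fin N) A)]
  refine IsHomogeneous.C_mul ?_ _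
  rw [Finsupp.degree_eq_sum]
  refine IsHomogeneous.prod _ _ _ fun i _ => ?_
  simpa using isHomogeneous_X_pow (R := A) (s i) (lam.rowLen i + (i.rev : ℕ))

/-! ### Antisymmetric polynomials as combinations of alternants -/

/-- Antisymmetric polynomials. -/
def IsAntisymmetric (f : MvPolynomial (Fin N) A) : Prop :=
  ∀ s : Equiv.Perm (Fin N), rename s f = (Equiv.Perm.sign s : ℤ) • f

theorem isAntisymmetric_evalDet (f : Fin N → Polynomial A) : IsAntisymmetric (evalDet f) :=
  rename_evalDet f

/-- Up to sign, a coefficient is unchanged by permuting the exponent. An exponent with distinct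
entries can be sorted into a strictly decreasing one; one with a repeated entry is fixed by a
transposition, so its coefficient equals its own negative. -/
theorem IsAntisymmetric.eq_zero [IsDomain A] [CharZero A] {f : MvPolynomial (Fin N) A}
    (hf : IsAntisymmetric f)
    (h : ∀ lam : YoungDiagram, lam.colLen 0 ≤ N → coeff (exponent lam N) f = 0) : f = 0 := by
  have hc : ∀ (s : Equiv.Perm (Fin N)) (k : Fin N →₀ ℕ),
      coeff k f = (Equiv.Perm.sign s : ℤ) • coeff (k.mapDomain s) f := by
    intro s k
    rw [← coeff_rename_mapDomain s s.injective, hf s, coeff_smul]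
  ext k
  rw [coeff_zero]
  by_cases hk : Function.Injective k
  · let s : Equiv.Perm (Fin N) := Fin.revPerm.trans (Tuple.sort k)
    have hanti : StrictAnti (k ∘ s) := by
      have h1 : StrictMono (k ∘ Tuple.sort k) :=
        (Tuple.monotone_sort k).strictMono_of_injective (hk.comp (Tuple.sort k).injective)
      intro i j hij
      exact h1 (Fin.rev_lt_rev.2 hij)
    rw [hc s.symm k]
    have h2 : ⇑(k.mapDomain s.symm) = k ∘ s := by
      ext i
      simp
    obtain ⟨lam, hl, he⟩ := exists_exponent_eq (k := k.mapDomain s.symm) (by rw [h2]; exact hanti)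
    rw [← he, h lam hl, smul_zero]
  · simp only [Function.Injective, not_forall] at hk
    obtain ⟨i, j, hij, hne⟩ := hk
    have h1 := hc (Equiv.swap i j) k
    have h2 : k.mapDomain (Equiv.swap i j) = k := by
      ext l
      have := Finsupp.mapDomain_apply (Equiv.swap i j).injective k (Equiv.swap i j l)
      rw [Equiv.swap_apply_self] at this
      rw [this]
      by_cases hi : l = i
      · subst hi; simp [hij]
      by_cases hj : l = j
      · subst hj; simp [hij]
      rw [Equiv.swap_apply_of_ne_of_ne hi hj]
    rw [h2, Equiv.Perm.sign_swap hne] at h1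
    simp only [Units.val_neg, Units.val_one, neg_smul, one_smul] at h1
    exact self_eq_neg.1 h1

/-- The diagrams with at most `d` cells and at most `N` rows. -/
def boundedDiagrams (d N : ℕ) : Finset YoungDiagram :=
  (diagramsLE d).filter fun lam => lam.colLen 0 ≤ N

@[simp] theorem mem_boundedDiagrams {d N : ℕ} {lam : YoungDiagram} :
    lam ∈ boundedDiagrams d N ↔ lam.card ≤ d ∧ lam.colLen 0 ≤ N := by
  simp [boundedDiagrams]

theorem coeff_exponent_sum {d : ℕ} (c : YoungDiagram → A) {mu : YoungDiagram}
    (hm : mu ∈ boundedDiagrams d N) :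
    coeff (exponent mu N) (∑ lam ∈ boundedDiagrams d N, C (c lam) * alternantOver A lam N) =
      c mu := by
  rw [coeff_sum, Finset.sum_eq_single mu]
  · rw [coeff_C_mul, coeff_alternantOver (by simp_all) (by simp_all)]
    simp [delta]
  · intro lam hl hne
    rw [coeff_C_mul, coeff_alternantOver (by simp_all) (by simp_all)]
    simp [delta, hne]
  · exact fun h => absurd hm h

theorem card_le_totalDegree {f : MvPolynomial (Fin N) A} {lam : YoungDiagram}
    (hl : lam.colLen 0 ≤ N) (h : coeff (exponent lam N) f ≠ 0) : lam.card ≤ f.totalDegree := by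
  by_contra hlt
  refine h (coeff_eq_zero_of_totalDegree_lt ?_)
  change _ < (exponent lam N).degree
  rw [degree_exponent hl]
  omega

/-- An antisymmetric polynomial is a combination of alternants. -/
theorem IsAntisymmetric.eq_sum [IsDomain A] [CharZero A] {f : MvPolynomial (Fin N) A}
    (hf : IsAntisymmetric f) {d : ℕ} (hd : ∀ lam : YoungDiagram, lam.colLen 0 ≤ N →
      coeff (exponent lam N) f ≠ 0 → lam.card ≤ d) :
    f = ∑ lam ∈ boundedDiagrams d N, C (coeff (exponent lam N) f) * alternantOver A lam N := by
  -- The difference is antisymmetric, and its coefficients at all strictly decreasing exponents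
  -- vanish.
  rw [← sub_eq_zero]
  refine IsAntisymmetric.eq_zero ?_ ?_
  · intro s
    rw [map_sub, map_sum, hf s, smul_sub, Finset.smul_sum]
    congr 1
    refine Finset.sum_congr rfl fun lam _ => ?_
    rw [map_mul, rename_C, alternantOver, rename_evalDet, mul_smul_comm]
  · intro mu hm
    rw [coeff_sub, sub_eq_zero]
    by_cases hd' : mu.card ≤ d
    · rw [coeff_exponent_sum _ (by simp [hd', hm])]
    · have h0 : coeff (exponent mu N) f = 0 := of_not_not fun h => hd' (hd mu hm h)
      rw [h0, coeff_sum, Finset.sum_eq_zero]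
      intro lam hl
      rw [coeff_C_mul, coeff_alternantOver (by simp_all) hm]
      have : lam ≠ mu := by
        rintro rfl
        simp_all
      simp [delta, this]

end evalDet

end LR
end

noncomputable section

namespace LR

/-! ### Jacobi–Trudi formulas -/

section jacobiTrudi

variable {A : Type*} [CommRing A] {N : ℕ}

/-- The alternant of `lam` evaluated at a family of elements. -/
def altEval (x : Fin N → A) (lam : YoungDiagram) : A :=
  Matrix.det (Matrix.of fun i j : Fin N => x i ^ (lam.rowLen j + (j.rev : ℕ)))

theorem altEval_X (lam : YoungDiagram) :
    altEval (fun i : Fin N => (MvPolynomial.X i : MvPolynomial (Fin N) ℤ)) lam =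
      alternant lam N := rfl

/-- The polynomial `∏ (1 - x_i t)`. -/
def ePoly (s : Finset (Fin N)) (x : Fin N → A) : Polynomial A :=
  ∏ i ∈ s, (1 - Polynomial.C (x i) * Polynomial.X)

/-- The power series `∏ 1 / (1 - x_i t)`. -/
def hSeries (x : Fin N → A) : PowerSeries A :=
  ∏ i, PowerSeries.mk fun k => x i ^ k

theorem natDegree_ePoly_le (s : Finset (Fin N)) (x : Fin N → A) :
    (ePoly s x).natDegree ≤ s.card := by
  refine (Polynomial.natDegree_prod_le _ _).trans ?_
  rw [Finset.card_eq_sum_ones]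
  refine Finset.sum_le_sum fun i _ => ?_
  refine (Polynomial.natDegree_sub_le _ _).trans ?_
  rw [Polynomial.natDegree_one, Nat.max_eq_right (Nat.zero_le _)]
  exact Polynomial.natDegree_C_mul_le _ _ |>.trans Polynomial.natDegree_X_le

theorem ePoly_univ_eq (x : Fin N → A) (l : Fin N) :
    ePoly Finset.univ x =
      (1 - Polynomial.C (x l) * Polynomial.X) * ePoly (Finset.univ.erase l) x :=
  (Finset.mul_prod_erase _ _ (Finset.mem_univ l)).symm

theorem coeff_zero_ePoly (s : Finset (Fin N)) (x : Fin N → A) : (ePoly s x).coeff 0 = 1 := by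
  simp [Polynomial.coeff_zero_eq_eval_zero, ePoly, Polynomial.eval_prod]

theorem constantCoeff_hSeries (x : Fin N → A) : PowerSeries.coeff 0 (hSeries x) = 1 := by
  simp [hSeries, ← PowerSeries.coeff_zero_eq_constantCoeff_apply, PowerSeries.coeff_mk]

theorem one_sub_mul_mk_pow (a : A) :
    ((1 - Polynomial.C a * Polynomial.X : Polynomial A) : PowerSeries A) *
      PowerSeries.mk (fun k => a ^ k) = 1 := by
  ext n
  rw [Polynomial.coe_sub, Polynomial.coe_one, Polynomial.coe_mul, Polynomial.coe_C,
    Polynomial.coe_X, sub_mul, one_mul, mul_assoc, map_sub, PowerSeries.coeff_C_mul]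
  cases n with
  | zero => simp
  | succ n => simp [PowerSeries.coeff_succ_X_mul, PowerSeries.coeff_one, pow_succ']

theorem ePoly_mul_hSeries (x : Fin N → A) :
    (ePoly Finset.univ x : PowerSeries A) * hSeries x = 1 := by
  rw [ePoly, ← Polynomial.coeToPowerSeries.ringHom_apply, map_prod, hSeries,
    ← Finset.prod_mul_distrib]
  exact Finset.prod_eq_one fun i _ => one_sub_mul_mk_pow (x i)

/-- Omitting the factor of `x l` from the product cancels every factor of `hSeries x` except the
geometric series of `x l`. -/
theorem ePoly_erase_mul_hSeries (x : Fin N → A) (l : Fin N) :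
    (ePoly (Finset.univ.erase l) x : PowerSeries A) * hSeries x =
      PowerSeries.mk fun k => x l ^ k := by
  have h := ePoly_mul_hSeries x
  rw [ePoly_univ_eq x l, Polynomial.coe_mul] at h
  have h1 := one_sub_mul_mk_pow (x l)
  calc _ = ((1 - Polynomial.C (x l) * Polynomial.X : Polynomial A) : PowerSeries A) *
        PowerSeries.mk (fun k => x l ^ k) *
        ((ePoly (Finset.univ.erase l) x : PowerSeries A) * hSeries x) := by rw [h1, one_mul]
    _ = PowerSeries.mk (fun k => x l ^ k) *
        (((1 - Polynomial.C (x l) * Polynomial.X : Polynomial A) : PowerSeries A) *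
          (ePoly (Finset.univ.erase l) x : PowerSeries A) * hSeries x) := by ring
    _ = _ := by rw [h, mul_one]

/-- This is the coefficient of $t^n$ in the preceding identity. Read as a matrix product, it factors
the matrix of an alternant. -/
theorem sum_coeff_ePoly_mul_coeff_hSeries (x : Fin N → A) (l : Fin N) (n : ℕ) :
    ∑ k : Fin N, (ePoly (Finset.univ.erase l) x).coeff k.rev *
      PowerSeries.coeff n (PowerSeries.X ^ (k.rev : ℕ) * hSeries x) = x l ^ n := by
  have hdeg : (ePoly (Finset.univ.erase l) x).natDegree < N := by
    refine (natDegree_ePoly_le _ x).trans_lt ?_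
    rw [Finset.card_erase_of_mem (Finset.mem_univ l), Finset.card_univ, Fintype.card_fin]
    have := l.2
    omega
  have h := congrArg (PowerSeries.coeff n) (ePoly_erase_mul_hSeries x l)
  rw [PowerSeries.coeff_mk, (ePoly (Finset.univ.erase l) x).as_sum_range' N hdeg,
    ← Polynomial.coeToPowerSeries.ringHom_apply, map_sum, Finset.sum_mul, map_sum,
    ← Fin.sum_univ_eq_sum_range (fun k => PowerSeries.coeff n
      (Polynomial.coeToPowerSeries.ringHom (Polynomial.monomial k
        ((ePoly (Finset.univ.erase l) x).coeff k)) * hSeries x)) N] at h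
  rw [← h, ← Equiv.sum_comp Fin.revPerm]
  refine Finset.sum_congr rfl fun k _ => ?_
  rw [← Polynomial.C_mul_X_pow_eq_monomial, Polynomial.coeToPowerSeries.ringHom_apply,
    Polynomial.coe_mul, Polynomial.coe_pow, Polynomial.coe_C, Polynomial.coe_X, mul_assoc,
    PowerSeries.coeff_C_mul]
  simp

/-- The Jacobi–Trudi determinant `det (h_{lam_j - j + k})`. -/
def hDet (x : Fin N → A) (lam : YoungDiagram) : A :=
  Matrix.det (Matrix.of fun j k : Fin N =>
    PowerSeries.coeff (lam.rowLen j + (j.rev : ℕ)) (PowerSeries.X ^ (k.rev : ℕ) * hSeries x))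

/-- The dual Jacobi–Trudi determinant with signs, `det ((-1)^{lam_j - j + k} e_{lam_j - j + k})`. -/
def eDet (x : Fin N → A) (lam : YoungDiagram) : A :=
  Matrix.det (Matrix.of fun j k : Fin N =>
    (Polynomial.X ^ (k.rev : ℕ) * ePoly Finset.univ x).coeff (lam.rowLen j + (j.rev : ℕ)))

theorem hDet_bot (x : Fin N → A) : hDet x ⊥ = 1 := by
  rw [hDet, Matrix.det_of_isUpperTriangular]
  · refine Finset.prod_eq_one fun j _ => ?_
    simp only [Matrix.of_apply, rowLen_bot, zero_add, PowerSeries.coeff_X_pow_mul', le_refl,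
      if_true, Nat.sub_self, constantCoeff_hSeries]
  · intro j k hkj
    have : (j.rev : ℕ) < k.rev := Fin.rev_lt_rev.2 hkj
    simp only [Matrix.of_apply, rowLen_bot, zero_add, PowerSeries.coeff_X_pow_mul',
      if_neg (not_le.2 this)]

/-- The Jacobi–Trudi formula. -/
theorem altEval_eq_mul_hDet (x : Fin N → A) (lam : YoungDiagram) :
    altEval x lam = altEval x ⊥ * hDet x lam := by
  -- The first factor does not depend on `mu`; the case `mu = ⊥`, where `hDet` is 1, identifies it
  -- with the Vandermonde determinant.
  have h : ∀ mu : YoungDiagram, altEval x mu =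
      Matrix.det (Matrix.of fun l k : Fin N => (ePoly (Finset.univ.erase l) x).coeff k.rev) *
        hDet x mu := by
    intro mu
    rw [hDet, ← Matrix.det_transpose (Matrix.of fun j k : Fin N => PowerSeries.coeff _ _),
      ← Matrix.det_mul, altEval]
    congr 1
    ext l j
    simp only [Matrix.of_apply, Matrix.mul_apply, Matrix.transpose_apply]
    exact (sum_coeff_ePoly_mul_coeff_hSeries x l _).symm
  rw [h lam, h ⊥, hDet_bot, mul_one]

/-! ### Boundary paths and the dual Jacobi–Trudi formula -/

theorem exists_erase_corner {lam : YoungDiagram} (h : lam ≠ ⊥) :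
    ∃ (mu : YoungDiagram) (a b : ℕ), lam.card = mu.card + 1 ∧ mu.rowLen a = b ∧ mu.colLen b = a ∧
      (∀ i, lam.rowLen i = mu.rowLen i + if i = a then 1 else 0) ∧
      (∀ j, lam.colLen j = mu.colLen j + if j = b then 1 else 0) := by
  have hpos : 0 < lam.colLen 0 := by
    by_contra h0
    apply h
    refine ext_rowLen fun i => ?_
    rw [rowLen_bot, rowLen_eq_zero_of_colLen_le (N := 0) (by omega) (Nat.zero_le i)]
  -- The cell removed is the last one of the last row.
  obtain ⟨a, ha⟩ : ∃ a, lam.colLen 0 = a + 1 := ⟨lam.colLen 0 - 1, by omega⟩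
  have hrow : 0 < lam.rowLen a :=
    YoungDiagram.mem_iff_lt_rowLen.1 (YoungDiagram.mem_iff_lt_colLen.2 (by omega))
  obtain ⟨b, hb⟩ : ∃ b, lam.rowLen a = b + 1 := ⟨lam.rowLen a - 1, by omega⟩
  have hmem : (a, b) ∈ lam := YoungDiagram.mem_iff_lt_rowLen.2 (by omega)
  let mu : YoungDiagram := ⟨lam.cells.erase (a, b), by
    rintro ⟨i, j⟩ ⟨i', j'⟩ ⟨hi, hj⟩ hc
    simp only [Finset.coe_erase, Set.mem_sdiff, Finset.mem_coe, YoungDiagram.mem_cells,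
      Set.mem_singleton_iff, Prod.mk.injEq, not_and] at hc hi hj ⊢
    refine ⟨lam.up_left_mem hi hj hc.1, ?_⟩
    rintro rfl rfl
    have h1 := YoungDiagram.mem_iff_lt_colLen.1 (lam.up_left_mem le_rfl (Nat.zero_le j) hc.1)
    have h2 : i = i' := by omega
    subst h2
    have h3 := YoungDiagram.mem_iff_lt_rowLen.1 hc.1
    exact hc.2 rfl (by omega)⟩
  have hins : lam.cells = insert (a, b) mu.cells := (Finset.insert_erase hmem).symm
  have hnot : (a, b) ∉ mu.cells := Finset.notMem_erase _ _
  have hr : ∀ i, lam.rowLen i = mu.rowLen i + if i = a then 1 else 0 := by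
    intro i
    rw [YoungDiagram.rowLen_eq_card, YoungDiagram.rowLen_eq_card, YoungDiagram.row,
      YoungDiagram.row, hins, Finset.filter_insert]
    by_cases hi : i = a
    · subst hi
      rw [if_pos rfl, if_pos rfl, Finset.card_insert_of_notMem]
      simp only [Finset.mem_filter, not_and]
      exact fun h => absurd h hnot
    · rw [if_neg (fun h => hi h.symm), if_neg hi, add_zero]
  have hc : ∀ j, lam.colLen j = mu.colLen j + if j = b then 1 else 0 := by
    intro j
    rw [YoungDiagram.colLen_eq_card, YoungDiagram.colLen_eq_card, YoungDiagram.col,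
      YoungDiagram.col, hins, Finset.filter_insert]
    by_cases hj : j = b
    · subst hj
      rw [if_pos rfl, if_pos rfl, Finset.card_insert_of_notMem]
      simp only [Finset.mem_filter, not_and]
      exact fun h => absurd h hnot
    · rw [if_neg (fun h => hj h.symm), if_neg hj, add_zero]
  refine ⟨mu, a, b, ?_, ?_, ?_, hr, hc⟩
  · rw [YoungDiagram.card, hins, Finset.card_insert_of_notMem hnot]
  · have := hr a
    rw [if_pos rfl] at this
    omega
  · have h1 := hc b
    rw [if_pos rfl] at h1
    have h2 := YoungDiagram.mem_iff_lt_colLen.1 hmem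
    have h3 := mt YoungDiagram.mem_iff_lt_colLen.2 hnot
    omega

/-- An enumeration of the integers below `2 * N`. -/
def position (N : ℕ) : Fin N ⊕ Fin N → ℕ := Sum.elim (fun i => N + (i : ℕ)) fun j => (j.rev : ℕ)

@[simp] theorem position_inl (i : Fin N) : position N (Sum.inl i) = N + (i : ℕ) := rfl

@[simp] theorem position_inr (j : Fin N) : position N (Sum.inr j) = (j.rev : ℕ) := rfl

theorem position_injective : Function.Injective (position N) := by
  rintro (i | i) (j | j) h
  · simp only [position_inl] at h
    exact congrArg _ (Fin.ext (by omega))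
  · simp only [position_inl, position_inr] at h
    have := j.rev.2
    omega
  · simp only [position_inl, position_inr] at h
    have := i.rev.2
    omega
  · simp only [position_inr] at h
    exact congrArg _ (Fin.rev_injective (Fin.ext h))

theorem sum_position (g : ℕ → A) : ∑ c, g (position N c) = ∑ k ∈ Finset.range (N + N), g k := by
  rw [Fintype.sum_sum_type, Finset.sum_range_add, add_comm, ← Fin.sum_univ_eq_sum_range,
    ← Fin.sum_univ_eq_sum_range (fun k => g (N + k)), ← Equiv.sum_comp Fin.revPerm]
  simp

/-- The positions of the vertical and horizontal steps of the boundary of a diagram. -/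
theorem exists_perm_position {lam : YoungDiagram} (hc : lam.colLen 0 ≤ N)
    (hr : lam.rowLen 0 ≤ N) :
    ∃ p : Equiv.Perm (Fin N ⊕ Fin N), Equiv.Perm.sign p = (-1) ^ lam.card ∧
      (∀ i : Fin N, position N (p (Sum.inl i)) + lam.colLen i = N + i) ∧
      ∀ j : Fin N, position N (p (Sum.inr j)) = lam.rowLen j + (j.rev : ℕ) := by
  induction hd : lam.card generalizing lam with
  | zero =>
    rw [card_eq_zero_iff] at hd
    subst hd
    exact ⟨1, by simp, by simp, by simp⟩
  | succ d ih =>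
    obtain ⟨mu, a, b, hcard, hab, hba, hrow, hcol⟩ := exists_erase_corner (lam := lam) (by
      rintro rfl
      simp [YoungDiagram.card] at hd)
    obtain ⟨p, hs, hl, hr'⟩ := ih (lam := mu) (by rw [hcol] at hc; omega)
      (by rw [hrow] at hr; omega) (by omega)
    have ha : a < N := by
      have h1 := hcol b
      rw [if_pos rfl] at h1
      have := lam.colLen_anti 0 b (Nat.zero_le b)
      omega
    have hb : b < N := by
      have h1 := hrow a
      rw [if_pos rfl] at h1
      have := lam.rowLen_anti 0 a (Nat.zero_le a)
      omega
    have hla := hl ⟨b, hb⟩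
    have hra := hr' ⟨a, ha⟩
    simp only [Fin.val_rev] at hla hra
    -- Adding the cell `(a, b)` exchanges two adjacent boundary steps, at positions `N + b - a - 1`
    -- and `N + b - a`; hence one change of sign per cell.
    refine ⟨p * Equiv.swap (Sum.inl ⟨b, hb⟩) (Sum.inr ⟨a, ha⟩), ?_, ?_, ?_⟩
    · rw [Equiv.Perm.sign_mul, hs, Equiv.Perm.sign_swap (by simp), pow_succ]
    · intro i
      rw [Equiv.Perm.mul_apply, hcol]
      by_cases hi : (i : ℕ) = b
      · have : i = ⟨b, hb⟩ := Fin.ext hi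
        subst this
        rw [Equiv.swap_apply_left, if_pos rfl]
        simp only
        omega
      · rw [Equiv.swap_apply_of_ne_of_ne (by simpa [Fin.ext_iff] using hi) (by simp), if_neg hi]
        exact hl i
    · intro j
      rw [Equiv.Perm.mul_apply, hrow]
      by_cases hj : (j : ℕ) = a
      · have : j = ⟨a, ha⟩ := Fin.ext hj
        subst this
        rw [Equiv.swap_apply_right, if_pos rfl]
        simp only [Fin.val_rev]
        omega
      · rw [Equiv.swap_apply_of_ne_of_ne (by simp) (by simpa [Fin.ext_iff] using hj), if_neg hj]
        exact hr' j

/-- The sum telescopes. When the top coefficient of `g` involved is zero, it says without division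
that $(1-aX)g$ vanishes at $1/a$. -/
theorem sum_pow_mul_coeff_one_sub_mul (a : A) (g : Polynomial A) {M n : ℕ} (hn : n ≤ M) :
    ∑ k ∈ Finset.range (n + 1),
      a ^ (M - k) * ((1 - Polynomial.C a * Polynomial.X) * g).coeff k =
      a ^ (M - n) * g.coeff n := by
  induction n with
  | zero => simp [sub_mul, mul_assoc]
  | succ n ih =>
    rw [Finset.sum_range_succ, ih (by omega), sub_mul, one_mul, mul_assoc, Polynomial.coeff_sub,
      Polynomial.coeff_C_mul, Polynomial.coeff_X_mul, show M - n = M - (n + 1) + 1 by omega]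
    ring

/-- The dual Jacobi–Trudi formula. -/
theorem altEval_mul_eDet (x : Fin N → A) {lam : YoungDiagram} (hc : lam.colLen 0 ≤ N)
    (hr : lam.rowLen 0 ≤ N) :
    altEval x ⊥ * eDet x lam = (-1) ^ lam.card * altEval x lam.transpose := by
  classical
  obtain ⟨p, hs, hl, hr'⟩ := exists_perm_position hc hr
  -- The determinant of `L * B` is computed in two ways. `B` is block triangular of determinant 1.
  -- Permuting the columns of `L` by `p` makes it block triangular with diagonal blocks the matrix
  -- of the alternant of the conjugate diagram and the identity.
  let L : Matrix (Fin N ⊕ Fin N) (Fin N ⊕ Fin N) A := Matrix.of fun r c =>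
    Sum.elim (fun i : Fin N => x i ^ (N + N - 1 - position N c))
      (fun j : Fin N => if position N c = lam.rowLen j + (j.rev : ℕ) then 1 else 0) r
  let B : Matrix (Fin N ⊕ Fin N) (Fin N ⊕ Fin N) A := Matrix.of fun r c =>
    Sum.elim (fun i => if r = Sum.inl i then 1 else 0)
      (fun j => (Polynomial.X ^ (j.rev : ℕ) * ePoly Finset.univ x).coeff (position N r)) c
  have hB : B.det = 1 := by
    rw [← Matrix.fromBlocks_toBlocks B]
    have h21 : B.toBlocks₂₁ = 0 := by
      ext i j
      simp [B, Matrix.toBlocks₂₁]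
    have h11 : B.toBlocks₁₁ = 1 := by
      ext i j
      simp [B, Matrix.toBlocks₁₁, Matrix.one_apply]
    rw [h21, h11, Matrix.det_fromBlocks_zero₂₁, Matrix.det_one, one_mul,
      Matrix.det_of_isUpperTriangular]
    · refine Finset.prod_eq_one fun j _ => ?_
      simp [B, Matrix.toBlocks₂₂, Polynomial.coeff_X_pow_mul', coeff_zero_ePoly]
    · intro j k hkj
      have : (j.rev : ℕ) < (k.rev : ℕ) := Fin.rev_lt_rev.2 hkj
      simp only [B, Matrix.toBlocks₂₂, Matrix.of_apply, Sum.elim_inr, position_inr,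
        Polynomial.coeff_X_pow_mul']
      exact if_neg (not_le.2 this)
  have hL : L.det = (-1) ^ lam.card * altEval x lam.transpose := by
    have h1 := Matrix.det_permute' p L
    have h2 : (L.submatrix id p).det = altEval x lam.transpose := by
      rw [← Matrix.fromBlocks_toBlocks (L.submatrix id p)]
      have h21 : (L.submatrix id p).toBlocks₂₁ = 0 := by
        ext i j
        simp only [L, Matrix.toBlocks₂₁, Matrix.submatrix_apply, id, Matrix.of_apply,
          Sum.elim_inr, Matrix.zero_apply]
        rw [if_neg]
        rw [← hr' i]
        intro h
        simpa using p.injective (position_injective h)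
      have h22 : (L.submatrix id p).toBlocks₂₂ = 1 := by
        ext i j
        simp only [L, Matrix.toBlocks₂₂, Matrix.submatrix_apply, id, Matrix.of_apply,
          Sum.elim_inr, Matrix.one_apply]
        rw [← hr' i]
        refine if_congr ?_ rfl rfl
        rw [position_injective.eq_iff, p.injective.eq_iff, Sum.inr.injEq, eq_comm]
      rw [h21, h22, Matrix.det_fromBlocks_zero₂₁, Matrix.det_one, mul_one, altEval]
      congr 1
      ext i j
      simp only [L, Matrix.toBlocks₁₁, Matrix.submatrix_apply, id, Matrix.of_apply,
        Sum.elim_inl, YoungDiagram.rowLen_transpose]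
      congr 1
      have h3 := hl j
      have h4 := j.2
      rw [Fin.val_rev]
      have h5 := lam.colLen_anti 0 j (Nat.zero_le _)
      omega
    rw [h2, hs] at h1
    rw [h1, ← mul_assoc]
    simp [← mul_pow]
  -- The upper right block of the product vanishes by the telescoping sum, since `ePoly` contains
  -- the factor `1 - x_i X`; the diagonal blocks are the Vandermonde matrix and that of `eDet`.
  have hLB : (L * B).det = altEval x ⊥ * eDet x lam := by
    rw [← Matrix.fromBlocks_toBlocks (L * B)]
    have h12 : (L * B).toBlocks₁₂ = 0 := by
      ext i j
      have hi := i.2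
      simp only [L, B, Matrix.toBlocks₁₂, Matrix.mul_apply, Matrix.of_apply, Sum.elim_inl,
        Sum.elim_inr, Matrix.zero_apply]
      refine (sum_position (N := N) fun k : ℕ => x i ^ (N + N - 1 - k) *
        (Polynomial.X ^ (j.rev : ℕ) * ePoly Finset.univ x).coeff k).trans ?_
      rw [ePoly_univ_eq x i,
        mul_left_comm, show N + N = (N + N - 1) + 1 by omega]
      simp only [Nat.add_sub_cancel]
      rw [sum_pow_mul_coeff_one_sub_mul _ _ le_rfl, Polynomial.coeff_eq_zero_of_natDegree_lt,
        mul_zero]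
      refine (Polynomial.natDegree_mul_le).trans_lt ?_
      have h1 := natDegree_ePoly_le (Finset.univ.erase i) x
      rw [Finset.card_erase_of_mem (Finset.mem_univ i), Finset.card_univ, Fintype.card_fin] at h1
      have h2 := Polynomial.natDegree_X_pow_le (R := A) (j.rev : ℕ)
      have h3 := j.rev.2
      omega
    rw [h12, Matrix.det_fromBlocks_zero₁₂, altEval, eDet]
    congr 2
    · ext i j
      simp only [L, B, Matrix.toBlocks₁₁, Matrix.mul_apply, Matrix.of_apply, Sum.elim_inl,
        mul_ite, mul_one, mul_zero, Finset.sum_ite_eq', Finset.mem_univ, if_true, position_inl,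
        rowLen_bot, Fin.val_rev]
      congr 1
      omega
    · ext i j
      simp only [L, B, Matrix.toBlocks₂₂, Matrix.mul_apply, Matrix.of_apply, Sum.elim_inr,
        ite_mul, one_mul, zero_mul]
      rw [Finset.sum_eq_single (p (Sum.inr i)), if_pos (hr' i), hr' i]
      · intro c _ hne
        rw [if_neg]
        rw [← hr' i]
        exact fun h => hne (position_injective h)
      · simp
  rw [← hLB, Matrix.det_mul, hB, mul_one, hL]

end jacobiTrudi

end LR
end

noncomputable section

namespace LR

open MvPolynomial

/-! ### Products of Schur functions -/

/-- The alternant of a diagram with at most `N` rows, and `0` for the other diagrams. -/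
def cutAlternant (lam : YoungDiagram) (N : ℕ) : MvPolynomial (Fin N) ℤ :=
  if lam.colLen 0 ≤ N then alternant lam N else 0

theorem cutAlternant_of_le {lam : YoungDiagram} {N : ℕ} (h : lam.colLen 0 ≤ N) :
    cutAlternant lam N = alternant lam N := if_pos h

theorem alternant_bot_ne_zero (N : ℕ) : alternant ⊥ N ≠ 0 :=
  alternant_ne_zero (by simp)

theorem algebraMap_alternant_bot_ne_zero (N : ℕ) :
    algebraMap _ (FractionRing (MvPolynomial (Fin N) ℤ)) (alternant ⊥ N) ≠ 0 := by
  simpa using alternant_bot_ne_zero N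

theorem schurPoly_eq (lam : YoungDiagram) (N : ℕ) :
    schurPoly lam N = algebraMap _ (FractionRing (MvPolynomial (Fin N) ℤ)) (cutAlternant lam N) /
      algebraMap _ (FractionRing (MvPolynomial (Fin N) ℤ)) (alternant ⊥ N) := by
  unfold schurPoly cutAlternant
  split_ifs <;> simp

/-! ### Restriction to fewer variables -/

/-- Setting the last variable to zero. -/
def killLast (N : ℕ) : MvPolynomial (Fin (N + 1)) ℤ →ₐ[ℤ] MvPolynomial (Fin N) ℤ :=
  aeval (Fin.lastCases 0 X)

@[simp] theorem killLast_X_castSucc {N : ℕ} (i : Fin N) : killLast N (X i.castSucc) = X i := by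
  simp [killLast]

@[simp] theorem killLast_X_last (N : ℕ) : killLast N (X (Fin.last N)) = 0 := by
  simp [killLast]

/-- In the row of the variable set to zero only $0^0=1$ survives, in the last column, and only if
`lam` has at most `N` rows. In the remaining minor every staircase exponent is one too large, whence
the product of the variables. -/
theorem killLast_cutAlternant (lam : YoungDiagram) (N : ℕ) :
    killLast N (cutAlternant lam (N + 1)) = (∏ i, X i) * cutAlternant lam N := by
  by_cases h1 : lam.colLen 0 ≤ N + 1
  swap
  · rw [cutAlternant, if_neg h1, cutAlternant, if_neg (by omega)]
    simp
  have hlast : ∀ j : Fin (N + 1), killLast N (X (Fin.last N)) ^ (lam.rowLen j + (j.rev : ℕ)) =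
      if j = Fin.last N ∧ lam.colLen 0 ≤ N then 1 else 0 := by
    intro j
    rw [killLast_X_last]
    by_cases hj : j = Fin.last N
    · subst hj
      by_cases h2 : lam.colLen 0 ≤ N
      · simp [h2, rowLen_eq_zero_of_colLen_le h2]
      · have : 0 < lam.rowLen N :=
          YoungDiagram.mem_iff_lt_rowLen.1 (YoungDiagram.mem_iff_lt_colLen.2 (by omega))
        rw [zero_pow (by simp; omega), if_neg (by simp [h2])]
    · have : j.rev ≠ 0 := by
        intro h
        apply hj
        rw [← Fin.rev_rev j, h, Fin.rev_zero]
      have : (j.rev : ℕ) ≠ 0 := by simpa [Fin.ext_iff] using this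
      rw [zero_pow (by omega), if_neg (by simp [hj])]
  rw [cutAlternant_of_le h1, alternant, AlgHom.map_det, Matrix.det_succ_row _ (Fin.last N)]
  simp only [AlgHom.mapMatrix_apply, Matrix.map_apply, Matrix.of_apply, map_pow, hlast]
  by_cases h2 : lam.colLen 0 ≤ N
  · rw [Finset.sum_eq_single (Fin.last N) (by intro j _ hj; simp [hj]) (by simp),
      cutAlternant_of_le h2, alternant, ← Matrix.det_mul_column]
    simp only [h2, and_self, if_true, mul_one]
    rw [← two_mul, pow_mul, neg_one_sq, one_pow, one_mul]
    congr 1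
    ext1 i j
    simp only [Matrix.submatrix_apply, Matrix.map_apply, Matrix.of_apply, Fin.succAbove_last,
      map_pow, killLast_X_castSucc, Fin.val_castSucc, Fin.rev_castSucc, Fin.val_succ]
    rw [← add_assoc, pow_succ']
  · simp [h2, cutAlternant]

/-- The coefficients `c` give the expansion of `s_mu s_nu` in `N` variables. -/
def IsExpansion (mu nu : YoungDiagram) (N : ℕ) (c : YoungDiagram → ℤ) : Prop :=
  cutAlternant mu N * cutAlternant nu N =
    alternant ⊥ N * ∑ lam ∈ diagramsLE (mu.card + nu.card), C (c lam) * cutAlternant lam N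

theorem IsExpansion.of_succ {mu nu : YoungDiagram} {N : ℕ} {c : YoungDiagram → ℤ}
    (h : IsExpansion mu nu (N + 1) c) : IsExpansion mu nu N c := by
  have h1 := congrArg (killLast N) h
  rw [← cutAlternant_of_le (lam := ⊥) (by simp)] at h1
  simp only [map_mul, map_sum, killLast_cutAlternant] at h1
  have hX : (∏ i : Fin N, X i : MvPolynomial (Fin N) ℤ) ≠ 0 :=
    Finset.prod_ne_zero_iff.2 fun i _ => X_ne_zero i
  have hC : ∀ a : ℤ, killLast N (C a) = C a := fun a => (killLast N).commutes a
  rw [cutAlternant_of_le (lam := ⊥) (by simp)] at h1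
  refine mul_left_cancel₀ (mul_ne_zero hX hX) ?_
  have h2 : ∑ lam ∈ diagramsLE (mu.card + nu.card),
      killLast N (C (c lam)) * ((∏ i, X i) * cutAlternant lam N) =
      (∏ i, X i) * ∑ lam ∈ diagramsLE (mu.card + nu.card), C (c lam) * cutAlternant lam N := by
    rw [Finset.mul_sum]
    exact Finset.sum_congr rfl fun lam _ => by rw [hC, mul_left_comm]
  rw [mul_mul_mul_comm, h1, mul_mul_mul_comm, h2]

theorem IsExpansion.of_le {mu nu : YoungDiagram} {N M : ℕ} (hNM : N ≤ M) {c : YoungDiagram → ℤ}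
    (h : IsExpansion mu nu M c) : IsExpansion mu nu N c := by
  induction M, hNM using Nat.le_induction with
  | base => exact h
  | succ M _ ih => exact ih h.of_succ

theorem colLen_le_of_mem_diagramsLE {d N : ℕ} (hd : d ≤ N) {lam : YoungDiagram}
    (h : lam ∈ diagramsLE d) : lam.colLen 0 ≤ N :=
  (colLen_le_card lam 0).trans ((mem_diagramsLE.1 h).trans hd)

theorem boundedDiagrams_eq {d N : ℕ} (hd : d ≤ N) : boundedDiagrams d N = diagramsLE d := by
  ext lam
  rw [boundedDiagrams, Finset.mem_filter, and_iff_left_iff_imp]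
  exact colLen_le_of_mem_diagramsLE hd

theorem coeff_sum_cutAlternant {d N : ℕ} (hd : d ≤ N) (c : YoungDiagram → ℤ) {mu : YoungDiagram}
    (hm : mu ∈ diagramsLE d) :
    coeff (exponent mu N) (∑ lam ∈ diagramsLE d, C (c lam) * cutAlternant lam N) = c mu := by
  have h := coeff_exponent_sum (A := ℤ) c (mu := mu) (d := d) (N := N)
    (by rwa [boundedDiagrams_eq hd])
  rw [boundedDiagrams_eq hd] at h
  rw [← h]
  congr 1
  refine Finset.sum_congr rfl fun lam hl => ?_
  rw [cutAlternant_of_le (colLen_le_of_mem_diagramsLE hd hl), alternantOver_int]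

/-- With this many variables no diagram of the sum is cut off, so every coefficient can be read at
its exponent. -/
theorem IsExpansion.unique {mu nu : YoungDiagram} {N : ℕ} (hN : mu.card + nu.card ≤ N)
    {c c' : YoungDiagram → ℤ} (h : IsExpansion mu nu N c) (h' : IsExpansion mu nu N c')
    {lam : YoungDiagram} (hl : lam ∈ diagramsLE (mu.card + nu.card)) : c lam = c' lam := by
  have h1 := mul_left_cancel₀ (alternant_bot_ne_zero N) (h.symm.trans h')
  rw [← coeff_sum_cutAlternant hN c hl, h1, coeff_sum_cutAlternant hN c' hl]

/-- By Jacobi–Trudi the Vandermonde determinant divides the product of the two alternants. The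
quotient is antisymmetric, hence a combination of alternants, and homogeneity leaves only the
diagrams of the right size. -/
theorem exists_isExpansion_of_le {mu nu : YoungDiagram} {N : ℕ} (hN : mu.card + nu.card ≤ N) :
    ∃ c : YoungDiagram → ℤ, (∀ lam, c lam ≠ 0 → lam.card = mu.card + nu.card) ∧
      IsExpansion mu nu N c := by
  classical
  have hmu : mu.colLen 0 ≤ N := (colLen_le_card mu 0).trans (by omega)
  have hnu : nu.colLen 0 ≤ N := (colLen_le_card nu 0).trans (by omega)
  have hbot : (⊥ : YoungDiagram).colLen 0 ≤ N := by simp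
  obtain ⟨f, hf⟩ : ∃ f, alternant ⊥ N * f = alternant mu N * alternant nu N := by
    refine ⟨hDet (fun i : Fin N => (X i : MvPolynomial (Fin N) ℤ)) mu * alternant nu N, ?_⟩
    have := altEval_eq_mul_hDet (fun i : Fin N => (X i : MvPolynomial (Fin N) ℤ)) mu
    rw [altEval_X, altEval_X] at this
    rw [this]
    ring
  have hanti : ∀ lam, IsAntisymmetric (alternant lam N) := by
    intro lam
    rw [← alternantOver_int]
    exact isAntisymmetric_evalDet _
  have hfa : IsAntisymmetric f := by
    intro s
    have h1 := congrArg (rename s) hf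
    rw [map_mul, map_mul, hanti, hanti, hanti, smul_mul_smul_comm, ← hf, smul_mul_assoc] at h1
    have hs : (Equiv.Perm.sign s : ℤ) * (Equiv.Perm.sign s : ℤ) = 1 := by
      rw [← Units.val_mul, Int.units_mul_self, Units.val_one]
    rw [hs, one_smul] at h1
    refine mul_left_cancel₀ (alternant_bot_ne_zero N) ?_
    rw [mul_smul_comm, ← h1, smul_smul, hs, one_smul]
  let D := ∑ j : Fin N, (j.rev : ℕ)
  let d := mu.card + nu.card
  have hhom : ∀ lam : YoungDiagram, lam.colLen 0 ≤ N →
      (alternant lam N).IsHomogeneous (lam.card + D) := by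
    intro lam hl
    rw [← alternantOver_int]
    exact alternantOver_isHomogeneous hl
  let c : YoungDiagram → ℤ := fun lam => if lam.card = d then coeff (exponent lam N) f else 0
  refine ⟨c, fun lam h => ?_, ?_⟩
  · by_contra hne
    exact h (if_neg hne)
  have he := hfa.eq_sum (d := max d f.totalDegree)
    fun lam hl h => (card_le_totalDegree hl h).trans (le_max_right _ _)
  -- `D` is the degree of the Vandermonde determinant, so this is the degree of the product of the
  -- two alternants; a summand for `lam` has degree `lam.card + D + D`.
  have h1 := congrArg (homogeneousComponent (d + D + D)) hf
  have h2 : alternant mu N * alternant nu N ∈ homogeneousSubmodule (Fin N) ℤ (d + D + D) := by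
    have := (hhom mu hmu).mul (hhom nu hnu)
    rw [mem_homogeneousSubmodule]
    convert this using 1
    simp only [d]
    omega
  rw [homogeneousComponent_of_mem h2, if_pos rfl, he, Finset.mul_sum, map_sum] at h1
  rw [IsExpansion, cutAlternant_of_le hmu, cutAlternant_of_le hnu, ← h1, Finset.mul_sum]
  symm
  refine Finset.sum_subset_zero_on_sdiff ?_ ?_ ?_
  · intro lam hl
    rw [mem_boundedDiagrams]
    exact ⟨(mem_diagramsLE.1 hl).trans (le_max_left _ _), colLen_le_of_mem_diagramsLE hN hl⟩
  all_goals
    intro lam hl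
    have hl' : lam.colLen 0 ≤ N := by
      first
        | exact colLen_le_of_mem_diagramsLE hN hl
        | exact (mem_boundedDiagrams.1 (Finset.mem_sdiff.1 hl).1).2
    have h3 : alternant ⊥ N * (C (coeff (exponent lam N) f) * alternantOver ℤ lam N) ∈
        homogeneousSubmodule (Fin N) ℤ (lam.card + D + D) := by
      rw [alternantOver_int, mem_homogeneousSubmodule]
      convert (hhom ⊥ hbot).mul ((hhom lam hl').C_mul (coeff (exponent lam N) f)) using 1
      rw [card_eq_zero_iff.2 rfl]
      omega
    rw [homogeneousComponent_of_mem h3]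
  · rw [if_neg]
    have := (Finset.mem_sdiff.1 hl).2
    rw [mem_diagramsLE] at this
    simp only [d]
    omega
  · rw [cutAlternant_of_le hl', alternantOver_int]
    by_cases hc : lam.card = d
    · simp [c, hc]
    · rw [if_neg (by omega)]
      simp [c, hc]

/-- Coefficients found in `mu.card + nu.card` variables restrict to fewer variables; those found in
more variables restrict to them and agree by uniqueness. -/
theorem exists_isExpansion (mu nu : YoungDiagram) :
    ∃ c : YoungDiagram → ℤ, (∀ lam, c lam ≠ 0 → lam.card = mu.card + nu.card) ∧
      ∀ N, IsExpansion mu nu N c := by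
  obtain ⟨c, hc, he⟩ := exists_isExpansion_of_le (le_refl (mu.card + nu.card))
  refine ⟨c, hc, fun N => ?_⟩
  rcases le_total N (mu.card + nu.card) with hN | hN
  · exact he.of_le hN
  · obtain ⟨c', -, he'⟩ := exists_isExpansion_of_le hN
    have h1 : ∀ lam ∈ diagramsLE (mu.card + nu.card), c' lam = c lam := fun lam hl =>
      (he'.of_le hN).unique le_rfl he hl
    rw [IsExpansion, he']
    congr 1
    exact Finset.sum_congr rfl fun lam hl => by rw [h1 lam hl]

theorem sum_smul_schurPoly (s : Finset YoungDiagram) (c : YoungDiagram → ℤ) (N : ℕ) :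
    ∑ lam ∈ s, c lam • schurPoly lam N =
      algebraMap _ (FractionRing (MvPolynomial (Fin N) ℤ))
        (∑ lam ∈ s, C (c lam) * cutAlternant lam N) /
        algebraMap _ (FractionRing (MvPolynomial (Fin N) ℤ)) (alternant ⊥ N) := by
  rw [map_sum, Finset.sum_div]
  refine Finset.sum_congr rfl fun lam _ => ?_
  rw [schurPoly_eq, ← smul_eq_C_mul, map_zsmul, smul_div_assoc]

theorem isExpansion_iff {mu nu : YoungDiagram} {N : ℕ} {c : YoungDiagram → ℤ} :
    IsExpansion mu nu N c ↔ schurPoly mu N * schurPoly nu N =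
      ∑ lam ∈ diagramsLE (mu.card + nu.card), c lam • schurPoly lam N := by
  have h0 := algebraMap_alternant_bot_ne_zero N
  rw [sum_smul_schurPoly, schurPoly_eq, schurPoly_eq, div_mul_div_comm, div_eq_div_iff (mul_ne_zero h0 h0) h0,
    ← map_mul, ← map_mul, ← map_mul, ← map_mul,
    (IsFractionRing.injective (MvPolynomial (Fin N) ℤ)
      (FractionRing (MvPolynomial (Fin N) ℤ))).eq_iff, IsExpansion]
  constructor
  · intro h
    rw [h]
    ring
  · intro h
    refine mul_right_cancel₀ (alternant_bot_ne_zero N) ?_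
    rw [h]
    ring

/-! ### Littlewood–Richardson coefficients as coefficients of products -/

theorem schurMulCoeffs_spec (mu nu : YoungDiagram) :
    Finsupp.linearCombination ℤ schur (schurMulCoeffs mu nu) = schur mu * schur nu ∧
      ∀ lam, schurMulCoeffs mu nu lam ≠ 0 → lam.card = mu.card + nu.card := by
  classical
  obtain ⟨c, hc, he⟩ := exists_isExpansion mu nu
  let c' : YoungDiagram →₀ ℤ := Finsupp.onFinset (diagramsLE (mu.card + nu.card)) c fun lam h =>
    mem_diagramsLE.2 (hc lam h).le
  have h1 : schur mu * schur nu = c'.sum fun lam a => a • schur lam := by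
    rw [Finsupp.onFinset_sum _ (by simp)]
    funext N
    rw [Finset.sum_apply]
    exact isExpansion_iff.1 (he N)
  have hex : ∃ c : YoungDiagram →₀ ℤ, schur mu * schur nu = c.sum fun lam a => a • schur lam :=
    ⟨c', h1⟩
  have h2 : schurMulCoeffs mu nu = hex.choose := dif_pos hex
  have h3 : Finsupp.linearCombination ℤ schur (schurMulCoeffs mu nu) = schur mu * schur nu := by
    rw [h2, Finsupp.linearCombination_apply]
    exact hex.choose_spec.symm
  refine ⟨h3, ?_⟩
  -- Linear independence identifies the chosen coefficients with the homogeneous ones constructed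
  -- above.
  have h4 : schurMulCoeffs mu nu = c' := by
    apply linearIndependent_schur
    rw [h3, h1, Finsupp.linearCombination_apply]
  rw [h4]
  exact hc

theorem card_eq_of_lrCoeff_ne_zero {lam mu nu : YoungDiagram} (h : lrCoeff lam mu nu ≠ 0) :
    lam.card = mu.card + nu.card :=
  (schurMulCoeffs_spec mu nu).2 lam h

theorem schurMulCoeffs_support_subset {mu nu : YoungDiagram} {d : ℕ}
    (hd : mu.card + nu.card ≤ d) : (schurMulCoeffs mu nu).support ⊆ diagramsLE d := by
  intro lam hl
  rw [mem_diagramsLE, card_eq_of_lrCoeff_ne_zero (Finsupp.mem_support_iff.1 hl)]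
  exact hd

theorem schur_mul_schur (mu nu : YoungDiagram) {d : ℕ} (hd : mu.card + nu.card ≤ d) :
    schur mu * schur nu = ∑ lam ∈ diagramsLE d, lrCoeff lam mu nu • schur lam := by
  rw [← (schurMulCoeffs_spec mu nu).1, Finsupp.linearCombination_apply,
    Finsupp.sum_of_support_subset _ (schurMulCoeffs_support_subset hd) _ (by simp)]
  rfl

theorem isExpansion_lrCoeff (mu nu : YoungDiagram) (N : ℕ) :
    IsExpansion mu nu N fun lam => lrCoeff lam mu nu := by
  rw [isExpansion_iff]
  have := congrFun (schur_mul_schur mu nu le_rfl) N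
  rwa [Finset.sum_apply] at this

theorem schur_bot : schur ⊥ = 1 := by
  funext N
  rw [schur, schurPoly_eq, cutAlternant_of_le (by simp),
    div_self (algebraMap_alternant_bot_ne_zero N), Pi.one_apply]

theorem lrCoeff_bot (lam mu : YoungDiagram) : lrCoeff lam ⊥ mu = delta lam mu := by
  classical
  have h : schurMulCoeffs ⊥ mu = Finsupp.single mu 1 := by
    apply linearIndependent_schur
    rw [(schurMulCoeffs_spec _ _).1, schur_bot, one_mul, Finsupp.linearCombination_single, one_smul]
  rw [lrCoeff, h, Finsupp.single_apply, delta]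
  exact if_congr eq_comm rfl rfl

/-- The coefficients of the expansion of `s_mu s_nu s_eta`. -/
def schurMulCoeffs₃ (mu nu eta : YoungDiagram) : YoungDiagram →₀ ℤ :=
  (schurMulCoeffs mu nu).sum fun xi a => a • schurMulCoeffs xi eta

theorem linearCombination_schurMulCoeffs₃ (mu nu eta : YoungDiagram) :
    Finsupp.linearCombination ℤ schur (schurMulCoeffs₃ mu nu eta) =
      schur mu * schur nu * schur eta := by
  rw [schurMulCoeffs₃, map_finsuppSum, ← (schurMulCoeffs_spec mu nu).1,
    Finsupp.linearCombination_apply, Finsupp.sum, Finsupp.sum, Finset.sum_mul]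
  refine Finset.sum_congr rfl fun xi _ => ?_
  rw [map_zsmul, (schurMulCoeffs_spec xi eta).1, smul_mul_assoc]

theorem lrCoeff₃_eq (lam mu nu eta : YoungDiagram) :
    lrCoeff₃ lam mu nu eta = schurMulCoeffs₃ mu nu eta lam := by
  rw [lrCoeff₃, schurMulCoeffs₃, Finsupp.sum, Finsupp.finsetSum_apply,
    finsum_eq_sum_of_support_subset (s := (schurMulCoeffs mu nu).support)]
  · rfl
  · intro xi h
    rw [Finset.mem_coe, Finsupp.mem_support_iff]
    exact left_ne_zero_of_mul h

/-- Both sides are coordinates of the same element in the linearly independent family of Schur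
functions. This gives the regroupings of a triple product. -/
theorem lrCoeff₃_eq_of_mul_eq {a b c a' b' c' : YoungDiagram}
    (h : schur a * schur b * schur c = schur a' * schur b' * schur c') (lam : YoungDiagram) :
    lrCoeff₃ lam a b c = lrCoeff₃ lam a' b' c' := by
  rw [lrCoeff₃_eq, lrCoeff₃_eq]
  congr 1
  apply linearIndependent_schur
  rw [linearCombination_schurMulCoeffs₃, linearCombination_schurMulCoeffs₃, h]

theorem lrCoeff₃_eq_sum {lam mu nu eta : YoungDiagram} {d : ℕ} (hd : lam.card ≤ d) :
    lrCoeff₃ lam mu nu eta = ∑ xi ∈ diagramsLE d, lrCoeff xi mu nu * lrCoeff lam xi eta := by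
  rw [lrCoeff₃, finsum_eq_sum_of_support_subset]
  intro xi h
  have := card_eq_of_lrCoeff_ne_zero (right_ne_zero_of_mul h)
  rw [Finset.mem_coe, mem_diagramsLE]
  omega

theorem card_eq_of_lrCoeff₃_ne_zero {lam mu nu eta : YoungDiagram}
    (h : lrCoeff₃ lam mu nu eta ≠ 0) : lam.card = mu.card + nu.card + eta.card := by
  rw [lrCoeff₃_eq_sum le_rfl] at h
  obtain ⟨xi, -, hxi⟩ := Finset.exists_ne_zero_of_sum_ne_zero h
  rw [card_eq_of_lrCoeff_ne_zero (right_ne_zero_of_mul hxi),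
    card_eq_of_lrCoeff_ne_zero (left_ne_zero_of_mul hxi)]

end LR
end

noncomputable section

namespace LR

open MvPolynomial

/-! ### The Cauchy identities -/

section cauchy

variable {A : Type*} [CommRing A] {N : ℕ}

theorem coeff_evalDet_X_pow_mul_congr {g g' : Polynomial A} {M : ℕ}
    (h : ∀ k ≤ M, g.coeff k = g'.coeff k) {k : Fin N →₀ ℕ} (hk : ∀ i, k i ≤ M) :
    coeff k (evalDet fun j : Fin N => Polynomial.X ^ (j.rev : ℕ) * g) =
      coeff k (evalDet fun j : Fin N => Polynomial.X ^ (j.rev : ℕ) * g') := by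
  rw [coeff_evalDet, coeff_evalDet]
  congr 1
  ext i j
  simp only [Matrix.of_apply, Polynomial.coeff_X_pow_mul']
  split_ifs
  · exact h _ ((Nat.sub_le _ _).trans (hk i))
  · rfl

theorem exponent_le (lam : YoungDiagram) (i : Fin N) : exponent lam N i ≤ lam.card + N := by
  rw [exponent_apply]
  have h1 := rowLen_le_card lam i
  have h2 := i.rev.2
  omega

theorem coeff_exponent_evalDet_ePoly (x : Fin N → A) (lam : YoungDiagram) :
    coeff (exponent lam N)
      (evalDet fun j : Fin N => Polynomial.X ^ (j.rev : ℕ) * ePoly Finset.univ x) = eDet x lam :=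
  coeff_evalDet _ _

/-- The Cauchy identity up to the order of truncation: the coefficient of an alternant in $y$ in the
Vandermonde determinant times the kernel is a Jacobi–Trudi determinant in $x$. -/
theorem coeff_exponent_evalDet_trunc (x : Fin N → A) {lam : YoungDiagram} {M : ℕ}
    (hM : lam.card + N < M) :
    coeff (exponent lam N)
      (evalDet fun j : Fin N => Polynomial.X ^ (j.rev : ℕ) * PowerSeries.trunc M (hSeries x)) =
      hDet x lam := by
  rw [coeff_evalDet, hDet]
  congr 1
  ext i j
  have h1 := exponent_le lam i
  simp only [Matrix.of_apply, Polynomial.coeff_X_pow_mul', PowerSeries.coeff_X_pow_mul',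
    PowerSeries.coeff_trunc, exponent_apply] at h1 ⊢
  congr 1
  rw [if_pos (by omega)]

theorem coeff_ePoly_mul_trunc (x : Fin N → A) {M k : ℕ} (hk : k < M) :
    (ePoly Finset.univ x * PowerSeries.trunc M (hSeries x)).coeff k =
      (1 : Polynomial A).coeff k := by
  have h := congrArg (PowerSeries.coeff k) (ePoly_mul_hSeries x)
  rw [PowerSeries.coeff_mul, PowerSeries.coeff_one] at h
  rw [Polynomial.coeff_mul, Polynomial.coeff_one, ← h]
  refine Finset.sum_congr rfl fun p hp => ?_
  have := Finset.HasAntidiagonal.mem_antidiagonal.1 hp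
  rw [PowerSeries.coeff_trunc, if_pos (by omega), Polynomial.coeff_coe]

theorem alternantOver_bot :
    alternantOver A ⊥ N = evalDet fun j : Fin N => Polynomial.X ^ (j.rev : ℕ) := by
  simp [alternantOver]

theorem alternantOver_bot_ne_zero [IsDomain A] : alternantOver A ⊥ N ≠ 0 := by
  intro h
  have := coeff_alternantOver (A := A) (N := N) (lam := ⊥) (mu := ⊥) (by simp) (by simp)
  simp [h, delta] at this

theorem alternantOver_mul_alternantOver {mu nu : YoungDiagram} (hm : mu.colLen 0 ≤ N)
    (hn : nu.colLen 0 ≤ N) :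
    alternantOver A mu N * alternantOver A nu N = alternantOver A ⊥ N *
      ∑ lam ∈ boundedDiagrams (mu.card + nu.card) N,
        C (lrCoeff lam mu nu : A) * alternantOver A lam N := by
  have h := congrArg (map (Int.castRingHom A)) (isExpansion_lrCoeff mu nu N)
  rw [map_mul, map_mul, cutAlternant_of_le hm, cutAlternant_of_le hn, map_alternant, map_alternant,
    map_alternant, map_sum] at h
  rw [h, boundedDiagrams, Finset.sum_filter]
  congr 1
  refine Finset.sum_congr rfl fun lam _ => ?_
  split_ifs with hl
  · rw [map_mul, map_C, cutAlternant_of_le hl, map_alternant]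
    simp
  · simp [cutAlternant, hl]

/-- The coefficient of `s_be (y)` in the product of the Cauchy identity
`∏ (1 - x_i y_j)⁻¹ = ∑ s_eta (x) s_eta (y)` and its dual. -/
theorem sum_eDet_mul_hDet [IsDomain A] [CharZero A] (x : Fin N → A) {be : YoungDiagram}
    (hb : be.colLen 0 ≤ N) :
    ∑ ta ∈ boundedDiagrams be.card N, ∑ eta ∈ boundedDiagrams be.card N,
      eDet x ta * hDet x eta * (lrCoeff be ta eta : A) = (delta ⊥ be : A) := by
  classical
  -- The inverse kernel is truncated to remain polynomial; this order exceeds every exponent of a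
  -- diagram with at most `be.card` cells.
  let M := be.card + N + 1
  let fE := evalDet fun j : Fin N => Polynomial.X ^ (j.rev : ℕ) * ePoly Finset.univ x
  let fH := evalDet fun j : Fin N =>
    Polynomial.X ^ (j.rev : ℕ) * PowerSeries.trunc M (hSeries x)
  let fEH := evalDet fun j : Fin N =>
    Polynomial.X ^ (j.rev : ℕ) * (ePoly Finset.univ x * PowerSeries.trunc M (hSeries x))
  have hmul : fE * fH = alternantOver A ⊥ N * fEH := by
    simp only [fE, fH, fEH, evalDet_mul, alternantOver_bot, map_mul, Finset.prod_mul_distrib]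
    ring
  obtain ⟨d, hd1, hd2⟩ : ∃ d, max fE.totalDegree fH.totalDegree ≤ d ∧ be.card ≤ d :=
    ⟨_, le_max_left _ be.card, le_max_right _ _⟩
  have hE : fE = _ := (isAntisymmetric_evalDet _).eq_sum (d := d) fun lam hl h =>
    (card_le_totalDegree hl h).trans ((le_max_left _ _).trans hd1)
  have hH : fH = _ := (isAntisymmetric_evalDet _).eq_sum (d := d) fun lam hl h =>
    (card_le_totalDegree hl h).trans ((le_max_right _ _).trans hd1)
  -- Both factors are expanded in alternants, whose products are rewritten with
  -- Littlewood–Richardson coefficients; one Vandermonde determinant cancels.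
  have hEH : fEH = ∑ ta ∈ boundedDiagrams d N, ∑ eta ∈ boundedDiagrams d N,
      ∑ lam ∈ boundedDiagrams (ta.card + eta.card) N,
        C (coeff (exponent ta N) fE * coeff (exponent eta N) fH * (lrCoeff lam ta eta : A)) *
          alternantOver A lam N := by
    refine mul_left_cancel₀ (alternantOver_bot_ne_zero (A := A) (N := N)) ?_
    rw [← hmul]
    conv_lhs => rw [hE, hH]
    rw [Finset.sum_mul_sum, Finset.mul_sum]
    refine Finset.sum_congr rfl fun ta hta => ?_
    rw [Finset.mul_sum]
    refine Finset.sum_congr rfl fun eta heta => ?_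
    rw [mul_mul_mul_comm, alternantOver_mul_alternantOver (mem_boundedDiagrams.1 hta).2
      (mem_boundedDiagrams.1 heta).2, mul_left_comm, ← C_mul, Finset.mul_sum]
    congr 1
    refine Finset.sum_congr rfl fun lam _ => ?_
    rw [← mul_assoc, ← C_mul]
  have hcoeff := congrArg (coeff (exponent be N)) hEH
  -- The two kernels multiply to 1 below the truncation order, so here `fEH` has the coefficient of
  -- the Vandermonde determinant.
  have hleft : coeff (exponent be N) fEH = (delta ⊥ be : A) := by
    rw [← coeff_alternantOver (A := A) (by simp) hb]
    refine (coeff_evalDet_X_pow_mul_congr (g' := 1) (M := be.card + N)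
      (fun k hk => coeff_ePoly_mul_trunc x (by omega)) (exponent_le be)).trans ?_
    simp [alternantOver_bot]
  have hterm : ∀ ta eta : YoungDiagram, coeff (exponent be N)
      (∑ lam ∈ boundedDiagrams (ta.card + eta.card) N,
        C (coeff (exponent ta N) fE * coeff (exponent eta N) fH * (lrCoeff lam ta eta : A)) *
          alternantOver A lam N) =
      eDet x ta * coeff (exponent eta N) fH * (lrCoeff be ta eta : A) := by
    intro ta eta
    rw [← coeff_exponent_evalDet_ePoly]
    by_cases h : be.card ≤ ta.card + eta.card
    · exact coeff_exponent_sum (fun lam => coeff (exponent ta N) fE *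
        coeff (exponent eta N) fH * (lrCoeff lam ta eta : A)) (mem_boundedDiagrams.2 ⟨h, hb⟩)
    · have h0 : lrCoeff be ta eta = 0 :=
        of_not_not fun h' => h (card_eq_of_lrCoeff_ne_zero h').le
      rw [h0, Int.cast_zero, mul_zero, coeff_sum]
      refine Finset.sum_eq_zero fun lam hl => ?_
      rw [mem_boundedDiagrams] at hl
      have hne : lam ≠ be := by
        rintro rfl
        exact h hl.1
      rw [coeff_C_mul, coeff_alternantOver hl.2 hb]
      simp [delta, hne]
  rw [hleft, coeff_sum] at hcoeff
  simp only [coeff_sum (boundedDiagrams d N), hterm] at hcoeff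
  have hsub : boundedDiagrams be.card N ⊆ boundedDiagrams d N := fun lam hl => by
    rw [mem_boundedDiagrams] at hl ⊢
    exact ⟨hl.1.trans hd2, hl.2⟩
  rw [hcoeff]
  -- Diagrams larger than `be`, for which the truncation could matter, do not contribute.
  have hout : ∀ ta eta : YoungDiagram, ta ∈ boundedDiagrams d N → eta ∈ boundedDiagrams d N →
      (ta ∉ boundedDiagrams be.card N ∨ eta ∉ boundedDiagrams be.card N) →
      lrCoeff be ta eta = 0 := by
    intro ta eta h1 h2 h3
    by_contra h
    have h4 := card_eq_of_lrCoeff_ne_zero h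
    simp only [mem_boundedDiagrams] at h1 h2 h3
    omega
  refine Finset.sum_subset_zero_on_sdiff hsub ?_ ?_
  · intro ta hta
    rw [Finset.mem_sdiff] at hta
    refine Finset.sum_eq_zero fun eta heta => ?_
    rw [hout ta eta hta.1 heta (Or.inl hta.2), Int.cast_zero, mul_zero]
  · intro ta hta
    refine Finset.sum_subset_zero_on_sdiff hsub ?_ ?_
    · intro eta heta
      rw [Finset.mem_sdiff] at heta
      rw [hout ta eta (hsub hta) heta.1 (Or.inr heta.2), Int.cast_zero, mul_zero]
    · intro eta heta
      rw [mem_boundedDiagrams] at heta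
      rw [coeff_exponent_evalDet_trunc x (by simp only [M]; omega)]

end cauchy

/-! ### The antipode relation -/

theorem algebraMap_hDet {lam : YoungDiagram} {N : ℕ} (h : lam.colLen 0 ≤ N) :
    algebraMap _ (FractionRing (MvPolynomial (Fin N) ℤ))
      (hDet (fun i : Fin N => (X i : MvPolynomial (Fin N) ℤ)) lam) = schurPoly lam N := by
  rw [schurPoly_eq, cutAlternant_of_le h, eq_div_iff (algebraMap_alternant_bot_ne_zero N),
    ← map_mul, mul_comm, ← altEval_X, ← altEval_X, ← altEval_eq_mul_hDet]

theorem algebraMap_eDet {lam : YoungDiagram} {N : ℕ} (h : lam.colLen 0 ≤ N)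
    (h' : lam.rowLen 0 ≤ N) :
    algebraMap _ (FractionRing (MvPolynomial (Fin N) ℤ))
      (eDet (fun i : Fin N => (X i : MvPolynomial (Fin N) ℤ)) lam) =
      (-1) ^ lam.card * schurPoly lam.transpose N := by
  rw [schurPoly_eq, cutAlternant_of_le (by rwa [YoungDiagram.colLen_transpose]), ← mul_div_assoc,
    eq_div_iff (algebraMap_alternant_bot_ne_zero N), ← map_mul, mul_comm, ← altEval_X,
    ← altEval_X, altEval_mul_eDet _ h h']
  simp

theorem eq_of_sum_smul_schurPoly_eq {d N : ℕ} (hd : d ≤ N) {a b : YoungDiagram → ℤ}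
    (h : ∑ lam ∈ diagramsLE d, a lam • schurPoly lam N =
      ∑ lam ∈ diagramsLE d, b lam • schurPoly lam N) {lam : YoungDiagram}
    (hl : lam ∈ diagramsLE d) : a lam = b lam := by
  have h0 := algebraMap_alternant_bot_ne_zero N
  rw [sum_smul_schurPoly, sum_smul_schurPoly, div_left_inj' h0, (IsFractionRing.injective (MvPolynomial (Fin N) ℤ)
      (FractionRing (MvPolynomial (Fin N) ℤ))).eq_iff] at h
  rw [← coeff_sum_cutAlternant hd a hl, h, coeff_sum_cutAlternant hd b hl]

/-- The antipode relation of the Hopf algebra of symmetric functions in terms of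
Littlewood–Richardson coefficients. -/
theorem sum_lrCoeff_transpose_mul_lrCoeff (al be : YoungDiagram) {d : ℕ} (hd : be.card ≤ d) :
    ∑ ta ∈ diagramsLE d, ∑ eta ∈ diagramsLE d,
      (-1 : ℤ) ^ ta.card * lrCoeff al ta.transpose eta * lrCoeff be ta eta =
      delta al ⊥ * delta be ⊥ := by
  classical
  -- Enough variables for rows and columns of all diagrams involved, for products of two diagrams
  -- with at most `d` cells, and for reading the coefficient at `al`.
  let N := d + d + al.card
  have hdN : d ≤ N := by simp only [N]; omega
  have hcol : ∀ ta ∈ diagramsLE d, ta.colLen 0 ≤ N := fun ta h => colLen_le_of_mem_diagramsLE hdN h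
  have hrow : ∀ ta ∈ diagramsLE d, ta.rowLen 0 ≤ N := fun ta h =>
    (rowLen_le_card ta 0).trans ((mem_diagramsLE.1 h).trans hdN)
  have hsub : diagramsLE be.card ⊆ diagramsLE d := fun lam hl => by
    rw [mem_diagramsLE] at hl ⊢
    omega
  have h1 := congrArg (algebraMap _ (FractionRing (MvPolynomial (Fin N) ℤ)))
    (sum_eDet_mul_hDet (fun i : Fin N => (X i : MvPolynomial (Fin N) ℤ)) (be := be)
      (hcol be (mem_diagramsLE.2 hd)))
  rw [boundedDiagrams_eq (hd.trans hdN), map_sum] at h1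
  -- The identity for the coefficient of $s_\beta(y)$ is now expanded in Schur polynomials in $x$,
  -- in order to compare coefficients at `al`.
  have h2 : ∑ lam ∈ diagramsLE N, (∑ ta ∈ diagramsLE be.card, ∑ eta ∈ diagramsLE be.card,
      (-1 : ℤ) ^ ta.card * lrCoeff lam ta.transpose eta * lrCoeff be ta eta) • schurPoly lam N =
      ∑ lam ∈ diagramsLE N, (delta lam ⊥ * delta be ⊥) • schurPoly lam N := by
    rw [Finset.sum_eq_single (s := diagramsLE N) (⊥ : YoungDiagram)
      (f := fun lam => (delta lam ⊥ * delta be ⊥) • schurPoly lam N)]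
    · have h3 : schurPoly ⊥ N = 1 := congrFun schur_bot N
      have h4 : (delta ⊥ ⊥ * delta be ⊥) • schurPoly ⊥ N =
          algebraMap (MvPolynomial (Fin N) ℤ) (FractionRing (MvPolynomial (Fin N) ℤ))
            (delta ⊥ be : MvPolynomial (Fin N) ℤ) := by
        rw [h3]
        simp [delta, eq_comm]
      rw [h4, ← h1]
      simp only [Finset.sum_smul]
      rw [Finset.sum_comm]
      refine Finset.sum_congr rfl fun ta hta => ?_
      rw [Finset.sum_comm, map_sum]
      refine Finset.sum_congr rfl fun eta heta => ?_
      rw [map_mul, map_mul, algebraMap_hDet (hcol eta (hsub heta)),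
        algebraMap_eDet (hcol ta (hsub hta)) (hrow ta (hsub hta))]
      have h5 : schurPoly ta.transpose N * schurPoly eta N =
          ∑ lam ∈ diagramsLE N, lrCoeff lam ta.transpose eta • schurPoly lam N := by
        have h6 := congrFun (schur_mul_schur ta.transpose eta (d := N) (by
          rw [card_transpose]
          have h7 := mem_diagramsLE.1 (hsub hta)
          have h8 := mem_diagramsLE.1 (hsub heta)
          simp only [N]
          omega)) N
        rwa [Finset.sum_apply] at h6
      rw [mul_assoc _ _ (schurPoly eta N), h5, Finset.mul_sum, Finset.sum_mul]
      refine Finset.sum_congr rfl fun lam _ => ?_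
      simp only [zsmul_eq_mul, map_intCast]
      push_cast
      ring
    · intro lam _ hlam
      simp [delta, hlam]
    · intro h
      exact absurd (mem_diagramsLE.2 (by rw [card_eq_zero_iff.2 rfl]; exact Nat.zero_le _)) h
  have h3 := eq_of_sum_smul_schurPoly_eq le_rfl h2 (lam := al)
    (mem_diagramsLE.2 (by simp only [N]; omega))
  rw [← h3]
  symm
  have hout : ∀ ta eta : YoungDiagram,
      (ta ∉ diagramsLE be.card ∨ eta ∉ diagramsLE be.card) → lrCoeff be ta eta = 0 := by
    intro ta eta h
    by_contra h0
    have h4 := card_eq_of_lrCoeff_ne_zero h0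
    simp only [mem_diagramsLE] at h
    omega
  refine Finset.sum_subset_zero_on_sdiff hsub ?_ ?_
  · intro ta hta
    refine Finset.sum_eq_zero fun eta _ => ?_
    rw [hout ta eta (Or.inl (Finset.mem_sdiff.1 hta).2), mul_zero]
  · intro ta _
    refine Finset.sum_subset hsub fun eta _ heta => ?_
    rw [hout ta eta (Or.inr heta), mul_zero]

end LR
end

namespace LR

/-! ### The four-fold sum -/

theorem finsum_eq_sum_diagramsLE {f : YoungDiagram → ℤ} {d : ℕ}
    (h : ∀ lam, f lam ≠ 0 → lam.card ≤ d) : ∑ᶠ lam, f lam = ∑ lam ∈ diagramsLE d, f lam :=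
  finsum_eq_sum_of_support_subset _ fun lam hl => by
    rw [Finset.mem_coe, mem_diagramsLE]
    exact h lam hl

theorem sum_comm₄ {ι : Type*} (s : Finset ι) (f : ι → ι → ι → ι → ℤ) :
    ∑ a ∈ s, ∑ b ∈ s, ∑ c ∈ s, ∑ e ∈ s, f a b c e =
      ∑ c ∈ s, ∑ e ∈ s, ∑ b ∈ s, ∑ a ∈ s, f a b c e := by
  have h : ∀ a, ∑ b ∈ s, ∑ c ∈ s, ∑ e ∈ s, f a b c e = ∑ c ∈ s, ∑ e ∈ s, ∑ b ∈ s, f a b c e := by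
    intro a
    rw [Finset.sum_comm]
    exact Finset.sum_congr rfl fun c _ => Finset.sum_comm
  simp only [h]
  rw [Finset.sum_comm]
  refine Finset.sum_congr rfl fun c _ => ?_
  rw [Finset.sum_comm]
  exact Finset.sum_congr rfl fun e _ => Finset.sum_comm

/-- Moving `nu` and `mu` to the last place of their triple products isolates an inner sum over `ta`
and `eta`, to which the antipode relation applies; only the empty diagrams remain. -/
theorem sum_lrCoeff₃_mul_lrCoeff₃ (lam mu nu om : YoungDiagram) {d : ℕ} (hl : lam.card ≤ d)
    (ho : om.card ≤ d) :
    ∑ eta ∈ diagramsLE d, ∑ ta ∈ diagramsLE d,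
      (-1 : ℤ) ^ ta.card * lrCoeff₃ lam ta.transpose nu eta * lrCoeff₃ om eta mu ta =
      delta lam nu * delta mu om := by
  classical
  have h1 : ∀ eta ta : YoungDiagram,
      (-1 : ℤ) ^ ta.card * lrCoeff₃ lam ta.transpose nu eta * lrCoeff₃ om eta mu ta =
      ∑ al ∈ diagramsLE d, ∑ be ∈ diagramsLE d, lrCoeff lam al nu * lrCoeff om be mu *
        ((-1 : ℤ) ^ ta.card * lrCoeff al ta.transpose eta * lrCoeff be ta eta) := by
    intro eta ta
    rw [lrCoeff₃_eq_of_mul_eq (a' := ta.transpose) (b' := eta) (c' := nu) (by ring) lam,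
      lrCoeff₃_eq_of_mul_eq (a' := ta) (b' := eta) (c' := mu) (by ring) om,
      lrCoeff₃_eq_sum hl, lrCoeff₃_eq_sum ho, mul_assoc, Finset.sum_mul_sum, Finset.mul_sum]
    refine Finset.sum_congr rfl fun al _ => ?_
    rw [Finset.mul_sum]
    refine Finset.sum_congr rfl fun be _ => ?_
    ring
  have hbot : (⊥ : YoungDiagram) ∈ diagramsLE d :=
    mem_diagramsLE.2 (by rw [card_eq_zero_iff.2 rfl]; exact Nat.zero_le _)
  calc _ = ∑ al ∈ diagramsLE d, ∑ be ∈ diagramsLE d, lrCoeff lam al nu * lrCoeff om be mu *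
        ∑ ta ∈ diagramsLE d, ∑ eta ∈ diagramsLE d,
          (-1 : ℤ) ^ ta.card * lrCoeff al ta.transpose eta * lrCoeff be ta eta := by
        simp only [h1, Finset.mul_sum]
        exact sum_comm₄ _ _
    _ = ∑ al ∈ diagramsLE d, ∑ be ∈ diagramsLE d, lrCoeff lam al nu * lrCoeff om be mu *
        (delta al ⊥ * delta be ⊥) := by
        refine Finset.sum_congr rfl fun al _ => Finset.sum_congr rfl fun be hbe => ?_
        rw [sum_lrCoeff_transpose_mul_lrCoeff al be (mem_diagramsLE.1 hbe)]
    _ = lrCoeff lam ⊥ nu * lrCoeff om ⊥ mu := by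
        rw [Finset.sum_eq_single_of_mem ⊥ hbot, Finset.sum_eq_single_of_mem ⊥ hbot]
        · simp [delta]
        · intro be _ hne
          simp [delta, hne]
        · intro al _ hne
          simp [delta, hne]
    _ = _ := by
        rw [lrCoeff_bot, lrCoeff_bot]
        simp [delta, eq_comm]

end LR

theorem mainTheorem6 (lam mu nu om : YoungDiagram) :
    -- the four-fold sum over all partitions `γ, η, σ, τ`: finitely many non-zero terms, and its value
    ({(γ, η, σ, τ) : YoungDiagram × YoungDiagram × YoungDiagram × YoungDiagram |
        (-1 : ℤ) ^ τ.card * LR.lrCoeff γ τ.transpose nu * LR.lrCoeff lam γ η *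
          LR.lrCoeff σ η mu * LR.lrCoeff om σ τ ≠ 0}.Finite ∧
      ∑ᶠ (γ : YoungDiagram) (η : YoungDiagram) (σ : YoungDiagram) (τ : YoungDiagram),
        (-1 : ℤ) ^ τ.card * LR.lrCoeff γ τ.transpose nu * LR.lrCoeff lam γ η *
          LR.lrCoeff σ η mu * LR.lrCoeff om σ τ = LR.delta lam nu * LR.delta mu om) ∧
    -- the same identity in terms of the triple coefficients
    ({(η, τ) : YoungDiagram × YoungDiagram |
        (-1 : ℤ) ^ τ.card * LR.lrCoeff₃ lam τ.transpose nu η * LR.lrCoeff₃ om η mu τ ≠ 0}.Finite ∧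
      ∑ᶠ (η : YoungDiagram) (τ : YoungDiagram),
        (-1 : ℤ) ^ τ.card * LR.lrCoeff₃ lam τ.transpose nu η * LR.lrCoeff₃ om η mu τ =
          LR.delta lam nu * LR.delta mu om) := by
  classical
  obtain ⟨d, hl, ho⟩ : ∃ d, lam.card ≤ d ∧ om.card ≤ d := ⟨_, le_max_left _ _, le_max_right _ _⟩
  -- Sizes add: a non-zero term has `γ` and `η` of total size `lam.card`, and `σ` and `τ` of total
  -- size `om.card`.
  have h4 : ∀ γ η σ τ : YoungDiagram,
      (-1 : ℤ) ^ τ.card * LR.lrCoeff γ τ.transpose nu * LR.lrCoeff lam γ η *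
        LR.lrCoeff σ η mu * LR.lrCoeff om σ τ ≠ 0 →
      γ.card ≤ d ∧ η.card ≤ d ∧ σ.card ≤ d ∧ τ.card ≤ d := by
    intro γ η σ τ h
    have e1 := LR.card_eq_of_lrCoeff_ne_zero (right_ne_zero_of_mul h)
    have e2 := LR.card_eq_of_lrCoeff_ne_zero
      (right_ne_zero_of_mul (left_ne_zero_of_mul (left_ne_zero_of_mul h)))
    omega
  have h2 : ∀ η τ : YoungDiagram,
      (-1 : ℤ) ^ τ.card * LR.lrCoeff₃ lam τ.transpose nu η * LR.lrCoeff₃ om η mu τ ≠ 0 →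
      η.card ≤ d ∧ τ.card ≤ d := by
    intro η τ h
    have e1 := LR.card_eq_of_lrCoeff₃_ne_zero (right_ne_zero_of_mul h)
    omega
  have hsum := LR.sum_lrCoeff₃_mul_lrCoeff₃ lam mu nu om hl ho
  refine ⟨⟨?_, ?_⟩, ?_, ?_⟩
  · refine (LR.diagramsLE d ×ˢ LR.diagramsLE d ×ˢ LR.diagramsLE d ×ˢ
      LR.diagramsLE d).finite_toSet.subset ?_
    rintro ⟨γ, η, σ, τ⟩ h
    simpa using h4 γ η σ τ h
  -- The nested `finsum`s become finite sums from the innermost outwards, each size bound passing to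
  -- the next level through a non-zero inner term.
  · have e1 : ∀ γ η σ : YoungDiagram, _ = _ := fun γ η σ =>
      LR.finsum_eq_sum_diagramsLE fun τ h => (h4 γ η σ τ h).2.2.2
    have e2 : ∀ γ η : YoungDiagram, _ = _ := fun γ η =>
      LR.finsum_eq_sum_diagramsLE (d := d) (f := fun σ => ∑ τ ∈ LR.diagramsLE d,
        (-1 : ℤ) ^ τ.card * LR.lrCoeff γ τ.transpose nu * LR.lrCoeff lam γ η *
          LR.lrCoeff σ η mu * LR.lrCoeff om σ τ) fun σ h => by
        obtain ⟨τ, -, h⟩ := Finset.exists_ne_zero_of_sum_ne_zero h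
        exact (h4 γ η σ τ h).2.2.1
    have e3 : ∀ γ : YoungDiagram, _ = _ := fun γ =>
      LR.finsum_eq_sum_diagramsLE (d := d) (f := fun η => ∑ σ ∈ LR.diagramsLE d,
        ∑ τ ∈ LR.diagramsLE d,
        (-1 : ℤ) ^ τ.card * LR.lrCoeff γ τ.transpose nu * LR.lrCoeff lam γ η *
          LR.lrCoeff σ η mu * LR.lrCoeff om σ τ) fun η h => by
        obtain ⟨σ, -, h⟩ := Finset.exists_ne_zero_of_sum_ne_zero h
        obtain ⟨τ, -, h⟩ := Finset.exists_ne_zero_of_sum_ne_zero h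
        exact (h4 γ η σ τ h).2.1
    have e4 := LR.finsum_eq_sum_diagramsLE (d := d) (f := fun γ => ∑ η ∈ LR.diagramsLE d,
        ∑ σ ∈ LR.diagramsLE d, ∑ τ ∈ LR.diagramsLE d,
        (-1 : ℤ) ^ τ.card * LR.lrCoeff γ τ.transpose nu * LR.lrCoeff lam γ η *
          LR.lrCoeff σ η mu * LR.lrCoeff om σ τ) fun γ h => by
        obtain ⟨η, -, h⟩ := Finset.exists_ne_zero_of_sum_ne_zero h
        obtain ⟨σ, -, h⟩ := Finset.exists_ne_zero_of_sum_ne_zero h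
        obtain ⟨τ, -, h⟩ := Finset.exists_ne_zero_of_sum_ne_zero h
        exact (h4 γ η σ τ h).1
    simp only [e1, e2, e3, e4]
    rw [← hsum, Finset.sum_comm]
    refine Finset.sum_congr rfl fun η hη => ?_
    -- Summation over `γ` and over `σ` assembles the two triple coefficients, so the four-fold sum
    -- is the double one.
    have e5 : ∀ τ ∈ LR.diagramsLE d,
        (-1 : ℤ) ^ τ.card * LR.lrCoeff₃ lam τ.transpose nu η * LR.lrCoeff₃ om η mu τ =
        ∑ γ ∈ LR.diagramsLE d, ∑ σ ∈ LR.diagramsLE d,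
          (-1 : ℤ) ^ τ.card * LR.lrCoeff γ τ.transpose nu * LR.lrCoeff lam γ η *
            LR.lrCoeff σ η mu * LR.lrCoeff om σ τ := by
      intro τ _
      rw [LR.lrCoeff₃_eq_sum hl, LR.lrCoeff₃_eq_sum ho, mul_assoc, Finset.sum_mul_sum,
        Finset.mul_sum]
      refine Finset.sum_congr rfl fun γ _ => ?_
      rw [Finset.mul_sum]
      refine Finset.sum_congr rfl fun σ _ => ?_
      ring
    rw [Finset.sum_congr rfl e5, Finset.sum_comm (s := LR.diagramsLE d) (t := LR.diagramsLE d)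
      (f := fun τ γ => ∑ σ ∈ LR.diagramsLE d,
          (-1 : ℤ) ^ τ.card * LR.lrCoeff γ τ.transpose nu * LR.lrCoeff lam γ η *
            LR.lrCoeff σ η mu * LR.lrCoeff om σ τ)]
    exact Finset.sum_congr rfl fun γ _ => Finset.sum_comm
  · refine (LR.diagramsLE d ×ˢ LR.diagramsLE d).finite_toSet.subset ?_
    rintro ⟨η, τ⟩ h
    simpa using h2 η τ h
  · have e1 : ∀ η : YoungDiagram, _ = _ := fun η =>
      LR.finsum_eq_sum_diagramsLE fun τ h => (h2 η τ h).2
    simp only [e1]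
    rw [LR.finsum_eq_sum_diagramsLE (d := d), hsum]
    intro η h
    obtain ⟨τ, -, h⟩ := Finset.exists_ne_zero_of_sum_ne_zero h
    exact (h2 η τ h).1
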